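/- Let $\mathbb X$ be a nonempty standard Borel space and $\mathbb P$ the space of its probability measures, with the Borel $\sigma$-field of the weak topology. For a nonzero finite measure $\beta$ on $\mathbb X$, let $\mathcal D(\beta)$ be the Dirichlet process law with base measure $\beta$: the unique probability measure on $\mathbb P$ under which, for every finite measurable partition $B_1,\dots,B_m$ of $\mathbb X$, the vector $(P(B_1),\dots,P(B_m))$ has the Dirichlet distribution with parameters $(\beta(B_1),\dots,\beta(B_m))$ (coordinates with parameter $0$ vanish almost surely). For $s>0$ and $\alpha^*\in\mathbb P$ write $Dp(s,\alpha^*)=\mathcal D(s\alpha^*)$. The imprecise Dirichlet process (IDP) with strength $s>0$ is the class of priors $\{Dp(s,\alpha^*):\alpha^*\in\mathbb P\}$, with $s$ fixed. Theorem. Let $s>0$, let $P\sim Dp(s,\alpha^*)$ and, given $P$, let $X_1,\dots,X_n$ be i.i.d. with law $P$. Then the conditional law of $P$ given $(X_1,\dots,X_n)$ is $$Dp\Big(s+n,\ \tfrac{s}{s+n}\alpha^*+\tfrac{1}{s+n}\sum_{i=1}^n\delta_{X_i}\Big)=\mathcal D\Big(s\alpha^*+\sum_{i=1}^n\delta_{X_i}\Big),$$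 and we take this version of the posterior for every value of the data. For a bounded measurable $f:\mathbb X\to\mathbb R$ put $E(f)=\int f\,dP$, let $\mathcal E[E(f)\mid X_1,\dots,X_n]$ be the expectation of $E(f)$ under this posterior, and let $\underline{\mathcal E}$ and $\overline{\mathcal E}$ be its infimum and supremum over $\alpha^*\in\mathbb P$. Then, for all values of $X_1,\dots,X_n$, $$\underline{\mathcal E}\big[E(f)\mid X_1,\dots,X_n\big]=\frac{s}{s+n}\inf f+\frac{n}{s+n}S_n(f),\qquad \overline{\mathcal E}\big[E(f)\mid X_1,\dots,X_n\big]=\frac{s}{s+n}\sup f+\frac{n}{s+n}S_n(f),$$ where $S_n(f)=\frac1n\sum_{i=1}^n f(X_i)$. Consequently, along any data sequence $X_1,X_2,\dots$, $$\overline{\mathcal E}\big[E(f)\mid X_1,\dots,X_n\big]-\underline{\mathcal E}\big[E(f)\mid X_1,\dots,X_n\big]=\frac{s}{s+n}(\sup f-\inf f)\longrightarrow 0\qquad(n\to\infty).$$ -/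

import Mathlib

open MeasureTheory ProbabilityTheory Filter Topology
open scoped ENNReal

universe u v

noncomputable section

/-- The gamma law with shape `a` and rate `1`; for shape `0` it is the unit mass at `0`. -/
def gammaShape (a : ℝ) : Measure ℝ :=
  if 0 < a then gammaMeasure a 1 else Measure.dirac 0

/-- The Dirichlet distribution with parameters `a i ≥ 0`, not all zero: the law of
`(Z i / ∑ j, Z j)` for independent gamma variables `Z i` with shapes `a i`. Parameters equal to
`0` are allowed, and give coordinates that vanish almost surely. -/
def dirichletMeasure {ι : Type*} [Fintype ι] (a : ι → ℝ) : Measure (ι → ℝ) :=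
  (Measure.pi fun i => gammaShape (a i)).map fun z i => z i / ∑ j, z j

/-- `μ` is the law of a Dirichlet process with base measure `β`: for every finite measurable
partition `B` of the space, the vector `(P (B i))` has, for `P` of law `μ`, the Dirichlet
distribution with parameters `β (B i)`. The space of probability measures carries the σ-algebra
generated by the evaluations `P ↦ P B`; on a standard Borel space this is the Borel σ-algebra of
the weak topology. -/
structure IsDirichletProcess {𝕏 : Type*} [MeasurableSpace 𝕏] (β : Measure 𝕏)
    (μ : Measure (ProbabilityMeasure 𝕏)) : Prop where
  isProbabilityMeasure : IsProbabilityMeasure μ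
  map_partition : ∀ (m : ℕ) (B : Fin m → Set 𝕏), (∀ i, MeasurableSet (B i)) →
    Pairwise (fun i j => Disjoint (B i) (B j)) → (⋃ i, B i) = Set.univ →
    μ.map (fun (P : ProbabilityMeasure 𝕏) i => (P : Measure 𝕏).real (B i)) = dirichletMeasure fun i => β.real (B i)

open Classical in
/-- The Dirichlet process law `𝒟(β)` with base measure `β`. -/
def dirichletProcess {𝕏 : Type*} [MeasurableSpace 𝕏] (β : Measure 𝕏) :
    Measure (ProbabilityMeasure 𝕏) :=
  if h : ∃ μ, IsDirichletProcess β μ then h.choose else 0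

/-- `Dp(s, α)`: the Dirichlet process law with strength `s` and normalized base measure `α`. -/
def dpPrior {𝕏 : Type*} [MeasurableSpace 𝕏] (s : ℝ) (α : ProbabilityMeasure 𝕏) :
    Measure (ProbabilityMeasure 𝕏) :=
  dirichletProcess (ENNReal.ofReal s • (α : Measure 𝕏))

/-- The law `Dp(s + n, s/(s+n) α + 1/(s+n) ∑ i, δ_{x i})`, whose base measure is
`s α + ∑ i, δ_{x i}`. -/
def dpPosterior {𝕏 : Type*} [MeasurableSpace 𝕏] (s : ℝ) (α : ProbabilityMeasure 𝕏) {n : ℕ}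
    (x : Fin n → 𝕏) : Measure (ProbabilityMeasure 𝕏) :=
  dirichletProcess (ENNReal.ofReal s • (α : Measure 𝕏) + ∑ i, Measure.dirac (x i))

/-- `X 0, …, X (n-1)` is an i.i.d. sample from the random probability measure `P`: given `P`, the
`X i` are independent with law `P`. -/
structure IsIIDSample {Ω 𝕏 : Type*} [MeasurableSpace Ω] [MeasurableSpace 𝕏] (ρ : Measure Ω)
    (P : Ω → ProbabilityMeasure 𝕏) {n : ℕ} (X : Fin n → Ω → 𝕏) : Prop where
  measurable_law : Measurable P
  measurable_sample : ∀ i, Measurable (X i)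
  measure_inter : ∀ (B : Set (ProbabilityMeasure 𝕏)) (A : Fin n → Set 𝕏), MeasurableSet B →
    (∀ i, MeasurableSet (A i)) →
    ρ {ω | P ω ∈ B ∧ ∀ i, X i ω ∈ A i} = ∫⁻ ω in P ⁻¹' B, ∏ i, (P ω : Measure 𝕏) (A i) ∂ρ

/-- The posterior expectation `𝓔[E(f) | X = x]` of `E(f) = ∫ f dP` for the prior `Dp(s, α)`. -/
def posteriorExpectation {𝕏 : Type*} [MeasurableSpace 𝕏] (s : ℝ) (α : ProbabilityMeasure 𝕏)
    {n : ℕ} (x : Fin n → 𝕏) (f : 𝕏 → ℝ) : ℝ :=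
  ∫ P : ProbabilityMeasure 𝕏, (∫ y, f y ∂(P : Measure 𝕏)) ∂(dpPosterior s α x)

/-- The posterior expectations of `E(f)` given `X = x`, over the imprecise Dirichlet process class
`{Dp(s, α) | α a probability measure}` of priors. -/
def idpPosteriorExpectations {𝕏 : Type*} [MeasurableSpace 𝕏] (s : ℝ) {n : ℕ} (x : Fin n → 𝕏)
    (f : 𝕏 → ℝ) : Set ℝ :=
  Set.range fun α : ProbabilityMeasure 𝕏 => posteriorExpectation s α x f

/-- The sample mean `S_n(f)`. -/
def sampleMean {𝕏 : Type*} {n : ℕ} (x : Fin n → 𝕏) (f : 𝕏 → ℝ) : ℝ :=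
  (∑ i, f (x i)) / n

end

/-!
Conjugacy and existence both rest on one identity for Dirichlet vectors. If `z` has independent
gamma coordinates with shapes `a i` and `S = ∑ i, z i`, then `S` is independent of `x = z / S`
(`gammaVector_map_sum_normalize`): tilting the law of `z` by `exp (-t S)` is the same as rescaling
`z`, so the Laplace transform of `S` is unchanged by conditioning on an event about `x`. Size biasing
`z j` raises the shape `a j` by one, and independence turns this into
`E_a [x j * g x] = (a j / ∑ i, a i) * E_{a + e_j} [g x]` (`lintegral_eval_mul_dirichletMeasure`).

*Existence.* By the same independence, `V e_j + (1 - V) x` has parameters `a + e_j` when `V` is an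
independent beta variable (`dirichletMeasure_stickStep`). Summing the size-biasing identity over `j`
shows that a Dirichlet vector keeps its law when mixed with a random vertex
(`sum_lintegral_stickStep`). Iterating this along i.i.d. proportions and locations, the
stick-breaking measure has Dirichlet masses on every finite partition, as the remainder of the stick
tends to `0` (`map_stickProbability_partition`).

*Uniqueness and measurability.* Events about the masses of the cells of finite partitions form a
π-system generating the σ-algebra on probability measures (`generateFrom_cylinderSets`), since
finitely many sets have a common refinement into atoms. A law is thus determined by its partition
vectors, and the posterior law is measurable in the data because on such an event it depends only on
the cells that the observations fall in.

*Posterior.* By a π-system argument it is enough to compare the joint laws of sample and random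
measure on products of cells with cylinder sets. There the sample contributes a monomial in the cell
masses, and iterated size biasing factors the mixed moment into a constant times the Dirichlet law
with one unit added per observation (`exists_measure_cell_inter`).

*Posterior expectations.* The mean of a Dirichlet process is its normalized base measure, so the
posterior expectation of `E(f)` is `(s ∫ f dα + ∑ i, f (x i)) / (s + n)`. Its bounds over `α` are
approached by unit masses.
-/

/-! ### Gamma laws -/

instance isProbabilityMeasure_gammaShape (a : ℝ) : IsProbabilityMeasure (gammaShape a) := by
  unfold gammaShape
  split_ifs with h
  · exact isProbabilityMeasure_gammaMeasure h one_pos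
  · infer_instance

lemma gammaShape_zero : gammaShape 0 = Measure.dirac 0 := by simp [gammaShape]

lemma gammaShape_Iio (a : ℝ) : gammaShape a (Set.Iio 0) = 0 := by
  unfold gammaShape
  split_ifs with h
  · rw [gammaMeasure, withDensity_apply _ measurableSet_Iio]
    exact lintegral_gammaPDF_of_nonpos le_rfl
  · simp

lemma gammaShape_ae_nonneg (a : ℝ) : ∀ᵐ z ∂gammaShape a, 0 ≤ z := by
  rw [ae_iff]
  simp only [not_le]
  exact gammaShape_Iio a

lemma gammaShape_ae_pos {a : ℝ} (ha : 0 < a) : ∀ᵐ z ∂gammaShape a, 0 < z := by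
  have h0 : gammaShape a {0} = 0 := by
    rw [gammaShape, if_pos ha, gammaMeasure, withDensity_apply _ (measurableSet_singleton 0)]
    simp
  have h1 : ∀ᵐ z ∂gammaShape a, z ≠ 0 := by
    rw [ae_iff]; simpa using h0
  filter_upwards [gammaShape_ae_nonneg a, h1] with z hz hz'
  exact lt_of_le_of_ne hz hz'.symm

lemma lintegral_eq_mul_lintegral_comp_mul_left {c : ℝ} (hc : 0 < c) {f : ℝ → ℝ≥0∞}
    (hf : Measurable f) : ∫⁻ y, f y = ENNReal.ofReal c * ∫⁻ z, f (c * z) := by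
  rw [← lintegral_map hf (measurable_const_mul c), Real.map_volume_mul_left hc.ne',
    lintegral_smul_measure, smul_eq_mul, ← mul_assoc, ← ENNReal.ofReal_mul hc.le,
    abs_of_pos (inv_pos.2 hc), mul_inv_cancel₀ hc.ne', ENNReal.ofReal_one, one_mul]

/-- Exponential tilting of a gamma law is a rescaling, up to the value `(1 + t) ^ (-a)` of its
Laplace transform. -/
lemma gammaShape_withDensity_exp {a t : ℝ} (ha : 0 ≤ a) (ht : 0 ≤ t) :
    (gammaShape a).withDensity (fun z => ENNReal.ofReal (Real.exp (-(t * z)))) =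
      ENNReal.ofReal ((1 + t) ^ (-a)) • (gammaShape a).map (fun z => (1 + t)⁻¹ * z) := by
  have hc : 0 < 1 + t := by linarith
  rcases ha.eq_or_lt with rfl | ha
  · refine Measure.ext_of_lintegral _ fun f hf => ?_
    rw [gammaShape_zero, lintegral_withDensity_eq_lintegral_mul _ (by fun_prop) hf,
      lintegral_smul_measure, lintegral_map hf (by fun_prop), lintegral_dirac, lintegral_dirac]
    simp
  refine Measure.ext_of_lintegral _ fun f hf => ?_
  have hm : Measurable (gammaPDF a 1) := (measurable_gammaPDFReal a 1).ennreal_ofReal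
  rw [lintegral_withDensity_eq_lintegral_mul _ (by fun_prop) hf, lintegral_smul_measure,
    lintegral_map hf (by fun_prop), gammaShape, if_pos ha, gammaMeasure,
    lintegral_withDensity_eq_lintegral_mul _ hm (by fun_prop),
    lintegral_withDensity_eq_lintegral_mul _ hm (by fun_prop), smul_eq_mul]
  conv_rhs => rw [lintegral_eq_mul_lintegral_comp_mul_left hc (by fun_prop), ← mul_assoc,
    ← lintegral_const_mul _ (by fun_prop)]
  refine lintegral_congr fun z => ?_
  simp only [Pi.mul_apply, gammaPDF]
  rw [inv_mul_cancel_left₀ hc.ne', ← mul_assoc, ← mul_assoc,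
    ← ENNReal.ofReal_mul (gammaPDFReal_nonneg ha one_pos _),
    ← ENNReal.ofReal_mul (by positivity : 0 ≤ (1 + t) ^ (-a)),
    ← ENNReal.ofReal_mul (by positivity : 0 ≤ (1 + t) ^ (-a) * (1 + t))]
  congr 2
  simp only [gammaPDFReal]
  by_cases hz : 0 ≤ z
  · rw [if_pos hz, if_pos (by positivity), Real.mul_rpow hc.le hz, Real.rpow_neg hc.le,
      Real.rpow_sub_one hc.ne', show -(1 * ((1 + t) * z)) = -(1 * z) + -(t * z) by ring,
      Real.exp_add]
    have := (Real.rpow_pos_of_pos hc a).ne'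
    field_simp
  · rw [if_neg hz, if_neg (by nlinarith)]; simp

/-- Size biasing raises the shape of a gamma law by `1`. -/
lemma gammaShape_withDensity_id {a : ℝ} (ha : 0 ≤ a) :
    (gammaShape a).withDensity ENNReal.ofReal = ENNReal.ofReal a • gammaShape (a + 1) := by
  rcases ha.eq_or_lt with rfl | ha
  · refine Measure.ext_of_lintegral _ fun f hf => ?_
    rw [gammaShape_zero, lintegral_withDensity_eq_lintegral_mul _ (by fun_prop) hf,
      lintegral_dirac]
    simp
  have hm (b : ℝ) : Measurable (gammaPDF b 1) := (measurable_gammaPDFReal b 1).ennreal_ofReal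
  rw [gammaShape, if_pos ha, gammaShape, if_pos (by linarith), gammaMeasure, gammaMeasure,
    ← withDensity_mul _ (hm a) (by fun_prop), ← withDensity_smul _ (hm _)]
  congr 1
  ext z
  simp only [Pi.mul_apply, Pi.smul_apply, gammaPDF, smul_eq_mul]
  rw [← ENNReal.ofReal_mul (gammaPDFReal_nonneg ha one_pos _), ← ENNReal.ofReal_mul ha.le]
  congr 1
  simp only [gammaPDFReal]
  by_cases hz : 0 ≤ z
  · rw [if_pos hz, if_pos hz, Real.Gamma_add_one ha.ne', Real.one_rpow, Real.one_rpow]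
    have : z ^ (a - 1) * z = z ^ (a + 1 - 1) := by
      rcases hz.eq_or_lt with rfl | hz
      · simp [Real.zero_rpow ha.ne']
      · rw [Real.rpow_sub_one hz.ne']; simp [hz.ne']
    rw [← this]
    have := (Real.Gamma_pos_of_pos ha).ne'
    field_simp
  · rw [if_neg hz, if_neg hz]; simp

/-! ### Finite measures determined by their Laplace transforms at the natural numbers -/

lemma unitInterval_measure_ext_of_moments {μ ν : Measure unitInterval} [IsFiniteMeasure μ]
    [IsFiniteMeasure ν] (h : ∀ n : ℕ, ∫ u, (u : ℝ) ^ n ∂μ = ∫ u, (u : ℝ) ^ n ∂ν) : μ = ν := by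
  have hint (ρ : Measure unitInterval) [IsFiniteMeasure ρ] (f : C(unitInterval, ℝ)) :
      Integrable f ρ :=
    (BoundedContinuousFunction.mkOfCompact f).integrable ρ
  have hpoly (p : Polynomial ℝ) :
      ∫ u : unitInterval, p.eval (u : ℝ) ∂μ = ∫ u : unitInterval, p.eval (u : ℝ) ∂ν := by
    have hi (ρ : Measure unitInterval) [IsFiniteMeasure ρ] (i : ℕ) :
        Integrable (fun u : unitInterval => p.coeff i * (u : ℝ) ^ i) ρ :=
      hint ρ ⟨fun u => p.coeff i * (u : ℝ) ^ i, by fun_prop⟩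
    simp only [Polynomial.eval_eq_sum_range]
    rw [integral_finsetSum _ fun i _ => hi μ i, integral_finsetSum _ fun i _ => hi ν i]
    simp only [integral_const_mul, h]
  refine ext_of_forall_integral_eq_of_IsFiniteMeasure fun f => ?_
  have hbound : ∀ ε > 0, |∫ u, f u ∂μ - ∫ u, f u ∂ν| ≤
      ε * (μ.real Set.univ + ν.real Set.univ) := by
    intro ε hε
    obtain ⟨p, hp⟩ := exists_polynomial_near_continuousMap 0 1 f.toContinuousMap ε hε
    have hp' (u : unitInterval) : ‖f u - p.eval (u : ℝ)‖ ≤ ε := by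
      have := (ContinuousMap.norm_coe_le_norm (p.toContinuousMapOn _ - f.toContinuousMap) u).trans
        hp.le
      rw [norm_sub_rev]
      simpa using this
    have hd (ρ : Measure unitInterval) [IsFiniteMeasure ρ] :
        |∫ u, f u ∂ρ - ∫ u : unitInterval, p.eval (u : ℝ) ∂ρ| ≤ ε * ρ.real Set.univ := by
      have hs := integral_sub (hint ρ f.toContinuousMap) (hint ρ (p.toContinuousMapOn unitInterval))
      simp only [BoundedContinuousFunction.coe_toContinuousMap,
        Polynomial.toContinuousMapOn_apply, Polynomial.toContinuousMap_apply] at hs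
      rw [← hs, ← Real.norm_eq_abs]
      exact norm_integral_le_of_norm_le_const (ae_of_all _ hp')
    have h1 := hd μ
    have h2 := hd ν
    rw [hpoly p] at h1
    rw [abs_le] at *
    constructor <;> linarith
  have hC : 0 ≤ μ.real Set.univ + ν.real Set.univ := by positivity
  by_contra hne
  have hpos : 0 < |∫ u, f u ∂μ - ∫ u, f u ∂ν| := abs_pos.2 (sub_ne_zero.2 hne)
  set C := μ.real Set.univ + ν.real Set.univ
  have := hbound (|∫ u, f u ∂μ - ∫ u, f u ∂ν| / (2 * (C + 1))) (by positivity)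
  rw [div_mul_eq_mul_div, le_div_iff₀ (by positivity)] at this
  nlinarith

/-- A finite measure on `[0, ∞)` is determined by its Laplace transform at the natural numbers:
the substitution `u = exp (-x)` turns these values into moments on `[0, 1]`. -/
lemma measure_ext_of_laplace_nat {μ ν : Measure ℝ} [IsFiniteMeasure μ] [IsFiniteMeasure ν]
    (hμ : ∀ᵐ x ∂μ, 0 ≤ x) (hν : ∀ᵐ x ∂ν, 0 ≤ x)
    (h : ∀ n : ℕ, ∫⁻ x, ENNReal.ofReal (Real.exp (-(n * x))) ∂μ =
      ∫⁻ x, ENNReal.ofReal (Real.exp (-(n * x))) ∂ν) : μ = ν := by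
  let e : ℝ → unitInterval := fun x => Set.projIcc 0 1 zero_le_one (Real.exp (-x))
  have he : Measurable e :=
    (continuous_projIcc.comp (Real.continuous_exp.comp continuous_neg)).measurable
  have hev {x : ℝ} (hx : 0 ≤ x) : (e x : ℝ) = Real.exp (-x) := by
    have h1 : Real.exp (-x) ∈ Set.Icc (0 : ℝ) 1 :=
      ⟨(Real.exp_pos _).le, Real.exp_le_one_iff.2 (by linarith)⟩
    simp only [e, Set.projIcc_of_mem zero_le_one h1]
  have hback (ρ : Measure ℝ) (hρ : ∀ᵐ x ∂ρ, 0 ≤ x) :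
      (ρ.map e).map (fun u : unitInterval => -Real.log u) = ρ := by
    have hl : Measurable fun u : unitInterval => -Real.log u := by fun_prop
    rw [Measure.map_map hl he]
    conv_rhs => rw [← Measure.map_id (μ := ρ)]
    refine Measure.map_congr ?_
    filter_upwards [hρ] with x hx
    simp [hev hx]
  have hmom (ρ : Measure ℝ) (hρ : ∀ᵐ x ∂ρ, 0 ≤ x) (n : ℕ) :
      ∫ u, (u : ℝ) ^ n ∂(ρ.map e) =
        (∫⁻ x, ENNReal.ofReal (Real.exp (-(n * x))) ∂ρ).toReal := by
    rw [integral_map he.aemeasurable (by fun_prop), ← integral_toReal (by fun_prop) (by simp)]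
    refine integral_congr_ae ?_
    filter_upwards [hρ] with x hx
    rw [hev hx, ENNReal.toReal_ofReal (Real.exp_pos _).le, ← Real.exp_nat_mul]
    simp
  rw [← hback μ hμ, ← hback ν hν]
  congr 1
  exact unitInterval_measure_ext_of_moments fun n => by rw [hmom μ hμ, hmom ν hν, h]

/-! ### Independent gamma variables: tilting, size biasing, and normalization -/

section

variable {ι : Type*} [Fintype ι]

/-- The law of a vector of independent gamma variables with shapes `a i`. -/
noncomputable abbrev gammaVector (a : ι → ℝ) : Measure (ι → ℝ) := Measure.pi fun i => gammaShape (a i)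

/-- A product density turns a product law into the product of the tilted factors; the factors `c i`
are the normalizing constants. -/
lemma pi_withDensity_prod {α : ι → Type*} [∀ i, MeasurableSpace (α i)]
    {μ ν : ∀ i, Measure (α i)} [∀ i, IsProbabilityMeasure (μ i)]
    [∀ i, IsProbabilityMeasure (ν i)] {f : ∀ i, α i → ℝ≥0∞} (hf : ∀ i, Measurable (f i))
    {c : ι → ℝ≥0∞} (hc : ∀ i, c i ≠ ∞) (h : ∀ i, (μ i).withDensity (f i) = c i • ν i) :
    (Measure.pi μ).withDensity (fun z => ∏ i, f i (z i)) = (∏ i, c i) • Measure.pi ν := by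
  have (i : ι) : IsFiniteMeasure (c i • ν i) := Measure.smul_finite _ (hc i)
  trans Measure.pi fun i => c i • ν i
  · refine (Measure.pi_eq fun s hs => ?_).symm
    rw [withDensity_apply _ (MeasurableSet.univ_pi hs),
      ← lintegral_indicator (MeasurableSet.univ_pi hs)]
    have hm (i : ι) : Measurable ((s i).indicator (f i)) := (hf i).indicator (hs i)
    have hprod : (Set.univ.pi s).indicator (fun z => ∏ i, f i (z i)) =
        fun z => ∏ i, (s i).indicator (f i) (z i) := by
      ext z
      by_cases hz : z ∈ Set.univ.pi s
      · rw [Set.indicator_of_mem hz]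
        exact Finset.prod_congr rfl fun i _ => (Set.indicator_of_mem (hz i trivial) _).symm
      · rw [Set.indicator_of_notMem hz]
        simp only [Set.mem_pi, Set.mem_univ, true_imp_iff, not_forall] at hz
        obtain ⟨i, hi⟩ := hz
        exact (Finset.prod_eq_zero (Finset.mem_univ i) (Set.indicator_of_notMem hi _)).symm
    rw [hprod, lintegral_prod_eq_prod_lintegral_of_indepFun Finset.univ
      (fun i (z : ∀ i, α i) => (s i).indicator (f i) (z i))
      (iIndepFun_pi fun i => (hm i).aemeasurable) (fun i => (hm i).comp (measurable_pi_apply i))]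
    refine Finset.prod_congr rfl fun i _ => ?_
    rw [← h i, withDensity_apply _ (hs i), ← lintegral_indicator (hs i),
      ← (measurePreserving_eval μ i).lintegral_comp (hm i)]
  · refine Measure.pi_eq fun s hs => ?_
    simp [Measure.pi_pi, Finset.prod_mul_distrib]

lemma gammaVector_withDensity_exp {a : ι → ℝ} (ha : ∀ i, 0 ≤ a i) {t : ℝ} (ht : 0 ≤ t) :
    (gammaVector a).withDensity (fun z => ENNReal.ofReal (Real.exp (-(t * ∑ i, z i)))) =
      ENNReal.ofReal ((1 + t) ^ (-∑ i, a i)) •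
        (gammaVector a).map (fun z i => (1 + t)⁻¹ * z i) := by
  have hpos : 0 < 1 + t := by linarith
  have (i : ι) : IsProbabilityMeasure ((gammaShape (a i)).map fun z => (1 + t)⁻¹ * z) :=
    Measure.isProbabilityMeasure_map (by fun_prop)
  have h := pi_withDensity_prod (fun _ => by fun_prop) (fun _ => ENNReal.ofReal_ne_top)
    (fun i => gammaShape_withDensity_exp (ha i) ht)
  rw [← ENNReal.ofReal_prod_of_nonneg (fun i _ => by positivity),
    ← Real.rpow_sum_of_pos hpos, Finset.sum_neg_distrib,
    ← Measure.pi_map_pi (fun i => by fun_prop)] at h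
  rw [← h]
  congr 1
  ext z
  rw [← ENNReal.ofReal_prod_of_nonneg (fun i _ => by positivity), ← Real.exp_sum,
    Finset.sum_neg_distrib, Finset.mul_sum]

lemma gammaVector_withDensity_eval [DecidableEq ι] {a : ι → ℝ} (ha : ∀ i, 0 ≤ a i) (j : ι) :
    (gammaVector a).withDensity (fun z => ENNReal.ofReal (z j)) =
      ENNReal.ofReal (a j) • gammaVector (a + Pi.single j 1) := by
  have h := pi_withDensity_prod (μ := fun i => gammaShape (a i))
    (ν := fun i => gammaShape ((a + Pi.single j 1 : ι → ℝ) i))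
    (f := fun i z => if i = j then ENNReal.ofReal z else 1)
    (c := fun i => if i = j then ENNReal.ofReal (a i) else 1)
    (fun i => by split_ifs <;> fun_prop) (fun i => by split_ifs <;> simp)
    (fun i => by
      rcases eq_or_ne i j with rfl | hij
      · simpa using gammaShape_withDensity_id (ha i)
      · simp [hij])
  convert h using 2
  · ext z
    rw [Finset.prod_eq_single j (fun i _ hij => by simp [hij]) (by simp)]
    simp
  · simp

lemma gammaVector_ae_nonneg (a : ι → ℝ) : ∀ᵐ z ∂gammaVector a, ∀ i, 0 ≤ z i := by
  rw [ae_all_iff]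
  exact fun i => (Measure.quasiMeasurePreserving_eval _ i).ae (gammaShape_ae_nonneg (a i))

lemma gammaVector_ae_sum_pos {a : ι → ℝ} (hs : 0 < ∑ i, a i) :
    ∀ᵐ z ∂gammaVector a, 0 < ∑ i, z i := by
  obtain ⟨j, -, hj⟩ := Finset.exists_lt_of_sum_lt (s := Finset.univ) (f := fun _ : ι => (0 : ℝ))
    (g := a) (by simpa using hs)
  filter_upwards [gammaVector_ae_nonneg a,
    (Measure.quasiMeasurePreserving_eval (μ := fun i => gammaShape (a i)) j).ae
      (gammaShape_ae_pos hj)] with z hz hzj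
  exact Finset.sum_pos' (fun i _ => hz i) ⟨j, Finset.mem_univ j, hzj⟩

lemma lintegral_exp_gammaShape {a t : ℝ} (ha : 0 ≤ a) (ht : 0 ≤ t) :
    ∫⁻ z, ENNReal.ofReal (Real.exp (-(t * z))) ∂gammaShape a = ENNReal.ofReal ((1 + t) ^ (-a)) := by
  have h := congrArg (fun μ => μ Set.univ) (gammaShape_withDensity_exp ha ht)
  simp only [withDensity_apply _ MeasurableSet.univ, Measure.restrict_univ, Measure.smul_apply,
    smul_eq_mul] at h
  rw [h, Measure.map_apply (by fun_prop) MeasurableSet.univ]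
  simp

lemma gammaShape_add {a b : ℝ} (ha : 0 ≤ a) (hb : 0 ≤ b) :
    ((gammaShape a).prod (gammaShape b)).map (fun p => p.1 + p.2) = gammaShape (a + b) := by
  have : IsProbabilityMeasure (((gammaShape a).prod (gammaShape b)).map fun p => p.1 + p.2) :=
    Measure.isProbabilityMeasure_map (by fun_prop)
  refine measure_ext_of_laplace_nat ?_ (gammaShape_ae_nonneg _) fun n => ?_
  · rw [ae_map_iff (by fun_prop) measurableSet_Ici]
    filter_upwards [Measure.quasiMeasurePreserving_fst.ae (gammaShape_ae_nonneg a),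
      Measure.quasiMeasurePreserving_snd.ae (gammaShape_ae_nonneg b)] with p h1 h2
    exact add_nonneg h1 h2
  · have hn : (0 : ℝ) ≤ n := n.cast_nonneg
    rw [lintegral_map (by fun_prop) (by fun_prop), lintegral_exp_gammaShape (by positivity) hn,
      neg_add, Real.rpow_add (by positivity), ENNReal.ofReal_mul (by positivity),
      ← lintegral_exp_gammaShape ha hn, ← lintegral_exp_gammaShape hb hn,
      ← lintegral_prod_mul (by fun_prop) (by fun_prop)]
    refine lintegral_congr fun p => ?_
    rw [← ENNReal.ofReal_mul (Real.exp_pos _).le, ← Real.exp_add]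
    congr 2
    ring

lemma measurable_normalize : Measurable fun (z : ι → ℝ) i => z i / ∑ j, z j := by
  refine measurable_pi_lambda _ fun i => ?_
  fun_prop

instance isProbabilityMeasure_dirichletMeasure (a : ι → ℝ) :
    IsProbabilityMeasure (dirichletMeasure a) :=
  Measure.isProbabilityMeasure_map measurable_normalize.aemeasurable

lemma dirichletMeasure_ae_nonneg (a : ι → ℝ) : ∀ᵐ x ∂dirichletMeasure a, ∀ i, 0 ≤ x i := by
  rw [dirichletMeasure, ae_map_iff measurable_normalize.aemeasurable
    (by simp only [Set.ofPred_forall]; measurability)]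
  filter_upwards [gammaVector_ae_nonneg a] with z hz i
  exact div_nonneg (hz i) (Finset.sum_nonneg fun i _ => hz i)

lemma dirichletMeasure_ae_sum_eq_one {a : ι → ℝ} (hs : 0 < ∑ i, a i) :
    ∀ᵐ x ∂dirichletMeasure a, ∑ i, x i = 1 := by
  rw [dirichletMeasure, ae_map_iff measurable_normalize.aemeasurable
    (measurableSet_eq_fun (by fun_prop) measurable_const)]
  filter_upwards [gammaVector_ae_sum_pos hs] with z hz
  rw [← Finset.sum_div, div_self hz.ne']

/-- For independent gamma variables the sum is independent of the normalized vector, and is itself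
a gamma variable. Tilting the law by `exp (-t ∑ z)` rescales the vector, which leaves events about
the normalized vector unchanged, so the Laplace transform of the sum restricted to such an event
is the one of a gamma law. -/
lemma gammaVector_map_sum_normalize {a : ι → ℝ} (ha : ∀ i, 0 ≤ a i) :
    (gammaVector a).map (fun z => (∑ i, z i, fun i => z i / ∑ j, z j)) =
      (gammaShape (∑ i, a i)).prod (dirichletMeasure a) := by
  refine (Measure.prod_eq fun s t hs ht => ?_).symm
  have hsum : Measurable fun z : ι → ℝ => ∑ i, z i := by fun_prop
  set E : Set (ι → ℝ) := (fun z i => z i / ∑ j, z j) ⁻¹' t with hE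
  have hEm : MeasurableSet E := measurable_normalize ht
  have key : ((gammaVector a).restrict E).map (fun z => ∑ i, z i) =
      (gammaVector a E) • gammaShape (∑ i, a i) := by
    have : IsFiniteMeasure (gammaVector a E • gammaShape (∑ i, a i)) :=
      Measure.smul_finite _ (measure_ne_top _ _)
    refine measure_ext_of_laplace_nat ?_ ?_ fun n => ?_
    · rw [ae_map_iff hsum.aemeasurable measurableSet_Ici]
      filter_upwards [ae_restrict_of_ae (gammaVector_ae_nonneg a)] with z hz
      exact Finset.sum_nonneg fun i _ => hz i
    · exact Measure.ae_smul_measure (gammaShape_ae_nonneg _) _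
    · have hn : (0 : ℝ) ≤ n := n.cast_nonneg
      have hn1 : (0 : ℝ) < 1 + n := by positivity
      rw [lintegral_map (by fun_prop) hsum, lintegral_smul_measure,
        lintegral_exp_gammaShape (Finset.sum_nonneg fun i _ => ha i) hn,
        ← withDensity_apply _ hEm, gammaVector_withDensity_exp ha hn, Measure.smul_apply,
        Measure.map_apply (by fun_prop) hEm, smul_eq_mul, smul_eq_mul, mul_comm]
      congr 2
      ext z
      simp only [hE, Set.mem_preimage, ← Finset.mul_sum]
      simp only [mul_div_mul_left _ _ (inv_pos.2 hn1).ne']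
  have h := congrArg (fun μ => μ s) key
  simp only [Measure.map_apply hsum hs, Measure.restrict_apply (hsum hs), Measure.smul_apply,
    smul_eq_mul] at h
  rw [Measure.map_apply (hsum.prodMk measurable_normalize) (hs.prod ht), dirichletMeasure,
    Measure.map_apply measurable_normalize ht, mul_comm]
  exact h

variable [DecidableEq ι]

/-- Size biasing a Dirichlet law by its `j`-th coordinate adds `1` to the `j`-th parameter. -/
lemma lintegral_eval_mul_dirichletMeasure {a : ι → ℝ} (ha : ∀ i, 0 ≤ a i) (hs : 0 < ∑ i, a i)
    (j : ι) {g : (ι → ℝ) → ℝ≥0∞} (hg : Measurable g) :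
    ∫⁻ x, ENNReal.ofReal (x j) * g x ∂dirichletMeasure a =
      ENNReal.ofReal (a j / ∑ i, a i) * ∫⁻ x, g x ∂dirichletMeasure (a + Pi.single j 1) := by
  have h1 : ∫⁻ z, ENNReal.ofReal (z j) * g (fun i => z i / ∑ k, z k) ∂gammaVector a =
      ENNReal.ofReal (a j) * ∫⁻ x, g x ∂dirichletMeasure (a + Pi.single j 1) := by
    rw [dirichletMeasure, lintegral_map hg measurable_normalize, ← smul_eq_mul (ENNReal.ofReal (a j)),
      ← lintegral_smul_measure, ← gammaVector_withDensity_eval ha,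
      lintegral_withDensity_eq_lintegral_mul _ (by fun_prop) (by fun_prop)]
    rfl
  have hmean : ∫⁻ r, ENNReal.ofReal r ∂gammaShape (∑ i, a i) = ENNReal.ofReal (∑ i, a i) := by
    have h := congrArg (fun μ => μ Set.univ) (gammaShape_withDensity_id hs.le)
    simpa [withDensity_apply _ MeasurableSet.univ] using h
  have h2 : ∫⁻ z, ENNReal.ofReal (z j) * g (fun i => z i / ∑ k, z k) ∂gammaVector a =
      ENNReal.ofReal (∑ i, a i) * ∫⁻ x, ENNReal.ofReal (x j) * g x ∂dirichletMeasure a := by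
    rw [← hmean, ← lintegral_prod_mul (by fun_prop) (by fun_prop),
      ← gammaVector_map_sum_normalize ha, lintegral_map (by fun_prop) (by fun_prop)]
    refine lintegral_congr_ae ?_
    filter_upwards [gammaVector_ae_sum_pos hs] with z hz
    rw [← mul_assoc, ← ENNReal.ofReal_mul hz.le, mul_div_cancel₀ _ hz.ne']
  have h3 : ENNReal.ofReal (∑ i, a i) ≠ 0 := by simpa using hs
  rw [ENNReal.ofReal_div_of_pos hs, ENNReal.div_eq_inv_mul, mul_assoc, ← h1, h2, ← mul_assoc,
    ENNReal.inv_mul_cancel h3 ENNReal.ofReal_ne_top, one_mul]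

/-- Adding an independent standard exponential variable to the `j`-th coordinate adds `1` to the
`j`-th shape. -/
lemma gammaVector_add_single {a : ι → ℝ} (ha : ∀ i, 0 ≤ a i) (j : ι) :
    ((gammaShape 1).prod (gammaVector a)).map (fun p => p.2 + Pi.single j p.1) =
      gammaVector (a + Pi.single j 1) := by
  have hmeas : Measurable fun p : ℝ × (ι → ℝ) => p.2 + Pi.single j p.1 := by
    refine measurable_pi_lambda _ fun i => ?_
    rcases eq_or_ne i j with rfl | hij
    · simp only [Pi.add_apply, Pi.single_eq_same]; fun_prop
    · simp only [Pi.add_apply, Pi.single_eq_of_ne hij]; fun_prop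
  refine (Measure.pi_eq fun s hs => ?_).symm
  have hj : gammaShape (a j + 1) (s j) =
      ∫⁻ g, gammaShape (a j) {z | z + g ∈ s j} ∂gammaShape 1 := by
    rw [← gammaShape_add (ha j) zero_le_one, Measure.map_apply (by fun_prop) (hs j),
      Measure.prod_apply_symm (measurable_add (hs j))]
    rfl
  have hsec (g : ℝ) : Prod.mk g ⁻¹' ((fun p : ℝ × (ι → ℝ) => p.2 + Pi.single j p.1) ⁻¹'
      Set.univ.pi s) = Set.univ.pi fun i => {z | z + (Pi.single j g : ι → ℝ) i ∈ s i} := by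
    ext z; simp
  rw [Measure.map_apply hmeas (MeasurableSet.univ_pi hs),
    Measure.prod_apply (hmeas (MeasurableSet.univ_pi hs)),
    ← Finset.mul_prod_erase _ _ (Finset.mem_univ j)]
  simp only [hsec, Measure.pi_pi, Pi.add_apply, Pi.single_eq_same]
  rw [hj, ← lintegral_mul_const'' _ (by
    exact (measurable_measure_prodMk_right (μ := gammaShape (a j))
      (measurable_add (hs j))).aemeasurable)]
  refine lintegral_congr fun g => ?_
  rw [← Finset.mul_prod_erase _ _ (Finset.mem_univ j), Pi.single_eq_same]
  congr 1
  refine Finset.prod_congr rfl fun i hi => ?_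
  simp [Pi.single_eq_of_ne (Finset.ne_of_mem_erase hi)]

end

/-- The law of the proportion broken off a stick: the beta distribution with parameters `1` and
`s`, as the law of `G / (G + Z)` for independent gamma variables of shapes `1` and `s`. -/
noncomputable def stickLaw (s : ℝ) : Measure unitInterval :=
  ((gammaShape 1).prod (gammaShape s)).map
    fun p => Set.projIcc 0 1 zero_le_one (p.1 / (p.1 + p.2))

lemma measurable_projIcc_div : Measurable fun p : ℝ × ℝ =>
    Set.projIcc (0 : ℝ) 1 zero_le_one (p.1 / (p.1 + p.2)) :=
  continuous_projIcc.measurable.comp (by fun_prop)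

instance isProbabilityMeasure_stickLaw (s : ℝ) : IsProbabilityMeasure (stickLaw s) :=
  Measure.isProbabilityMeasure_map measurable_projIcc_div.aemeasurable

lemma stickLaw_ae_pos (s : ℝ) : ∀ᵐ v : unitInterval ∂stickLaw s, 0 < (v : ℝ) := by
  rw [stickLaw, ae_map_iff measurable_projIcc_div.aemeasurable
    (measurableSet_lt measurable_const (by fun_prop))]
  filter_upwards [Measure.quasiMeasurePreserving_fst.ae (gammaShape_ae_pos one_pos),
    Measure.quasiMeasurePreserving_snd.ae (gammaShape_ae_nonneg s)] with p h1 h2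
  rw [Set.coe_projIcc]
  have : 0 < p.1 / (p.1 + p.2) := by positivity
  simp [this]

section

variable {ι : Type*} [DecidableEq ι]

lemma measurable_stickStep (j : ι) : Measurable fun (p : unitInterval × (ι → ℝ)) (i : ι) =>
    (p.1 : ℝ) * (Pi.single j 1 : ι → ℝ) i + (1 - p.1) * p.2 i := by
  refine measurable_pi_lambda _ fun i => ?_
  fun_prop

variable [Fintype ι]

/-- Mixing a Dirichlet vector with the vertex `j` in beta proportions adds `1` to the `j`-th
parameter. -/
lemma dirichletMeasure_stickStep {a : ι → ℝ} (ha : ∀ i, 0 ≤ a i) (hs : 0 < ∑ i, a i) (j : ι) :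
    ((stickLaw (∑ i, a i)).prod (dirichletMeasure a)).map
      (fun p i => (p.1 : ℝ) * (Pi.single j 1 : ι → ℝ) i + (1 - p.1) * p.2 i) =
      dirichletMeasure (a + Pi.single j 1) := by
  refine Measure.ext_of_lintegral _ fun f hf => ?_
  have hadd : Measurable fun p : ℝ × (ι → ℝ) => p.2 + Pi.single j p.1 := by
    refine measurable_pi_lambda _ fun i => ?_
    rcases eq_or_ne i j with rfl | hij
    · simp only [Pi.add_apply, Pi.single_eq_same]; fun_prop
    · simp only [Pi.add_apply, Pi.single_eq_of_ne hij]; fun_prop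
  set F : unitInterval × (ι → ℝ) → ℝ≥0∞ := fun p =>
    f fun i => (p.1 : ℝ) * (Pi.single j 1 : ι → ℝ) i + (1 - p.1) * p.2 i with hF
  have hFm : Measurable F := hf.comp (measurable_stickStep j)
  have hm1 : Measurable fun q : (ℝ × ℝ) × (ι → ℝ) =>
      F (Set.projIcc (0 : ℝ) 1 zero_le_one (q.1.1 / (q.1.1 + q.1.2)), q.2) :=
    hFm.comp ((measurable_projIcc_div.comp measurable_fst).prodMk measurable_snd)
  have hm2 : Measurable fun q : ℝ × (ℝ × (ι → ℝ)) =>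
      F (Set.projIcc (0 : ℝ) 1 zero_le_one (q.1 / (q.1 + q.2.1)), q.2.2) :=
    hm1.comp (f := fun q : ℝ × (ℝ × (ι → ℝ)) => ((q.1, q.2.1), q.2.2)) (by fun_prop)
  calc ∫⁻ x, f x ∂((stickLaw (∑ i, a i)).prod (dirichletMeasure a)).map _
      = ∫⁻ p, F p ∂((stickLaw (∑ i, a i)).prod (dirichletMeasure a)) :=
        lintegral_map hf (measurable_stickStep j)
    _ = ∫⁻ g, ∫⁻ q, F (Set.projIcc (0 : ℝ) 1 zero_le_one (g / (g + q.1)), q.2)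
          ∂(gammaShape (∑ i, a i)).prod (dirichletMeasure a) ∂gammaShape 1 := by
        rw [lintegral_prod _ hFm.aemeasurable, stickLaw,
          lintegral_map hFm.lintegral_prod_right' measurable_projIcc_div,
          lintegral_prod _ (hm1.lintegral_prod_right').aemeasurable]
        refine lintegral_congr fun g => ?_
        rw [lintegral_prod]
        exact (hm2.comp measurable_prodMk_left).aemeasurable
    _ = ∫⁻ g, ∫⁻ z, F (Set.projIcc (0 : ℝ) 1 zero_le_one (g / (g + ∑ i, z i)),
          fun i => z i / ∑ k, z k) ∂gammaVector a ∂gammaShape 1 := by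
        refine lintegral_congr fun g => ?_
        have hm3 : Measurable fun q : ℝ × (ι → ℝ) =>
            F (Set.projIcc (0 : ℝ) 1 zero_le_one (g / (g + q.1)), q.2) :=
          hm2.comp measurable_prodMk_left
        rw [← gammaVector_map_sum_normalize ha,
          lintegral_map hm3 (Measurable.prodMk (by fun_prop) measurable_normalize)]
    _ = ∫⁻ g, ∫⁻ z : ι → ℝ, f (fun i =>
            (z + Pi.single j g : ι → ℝ) i / ∑ k, (z + Pi.single j g : ι → ℝ) k)
          ∂gammaVector a ∂gammaShape 1 := by
        refine lintegral_congr_ae ?_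
        filter_upwards [gammaShape_ae_pos one_pos] with g hg
        refine lintegral_congr_ae ?_
        filter_upwards [gammaVector_ae_sum_pos hs] with z hz
        have hmem : g / (g + ∑ i, z i) ∈ Set.Icc (0 : ℝ) 1 :=
          ⟨by positivity, (div_le_one (by positivity)).2 (by linarith)⟩
        simp only [hF, Set.projIcc_of_mem zero_le_one hmem]
        congr 1
        ext i
        have hsum : ∑ k, (z + Pi.single j g : ι → ℝ) k = g + ∑ k, z k := by
          simp [Finset.sum_add_distrib, add_comm]
        have hsingle : (Pi.single j g : ι → ℝ) i = g * (Pi.single j 1 : ι → ℝ) i := by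
          simp [Pi.single_apply]
        rw [hsum, Pi.add_apply, hsingle]
        field_simp
        ring
    _ = ∫⁻ x, f x ∂dirichletMeasure (a + Pi.single j 1) := by
        have hfm : Measurable fun z : ι → ℝ => f fun i => z i / ∑ k, z k :=
          hf.comp measurable_normalize
        rw [dirichletMeasure, lintegral_map hf measurable_normalize,
          show (Measure.pi fun i => gammaShape ((a + Pi.single j 1 : ι → ℝ) i)) = _ from
            (gammaVector_add_single ha j).symm, lintegral_map hfm hadd]
        exact (lintegral_prod _ (hfm.comp hadd).aemeasurable).symm

/-- The distributional fixed-point equation behind stick-breaking: a Dirichlet vector keeps its law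
when mixed in beta proportions with a vertex chosen with probabilities `a j / ∑ i, a i`. -/
lemma sum_lintegral_stickStep {a : ι → ℝ} (ha : ∀ i, 0 ≤ a i) (hs : 0 < ∑ i, a i)
    {g : (ι → ℝ) → ℝ≥0∞} (hg : Measurable g) :
    ∑ j, ENNReal.ofReal (a j / ∑ i, a i) *
        ∫⁻ p, g (fun i => (p.1 : ℝ) * (Pi.single j 1 : ι → ℝ) i + (1 - p.1) * p.2 i)
          ∂(stickLaw (∑ i, a i)).prod (dirichletMeasure a) =
      ∫⁻ x, g x ∂dirichletMeasure a := by
  have h (j : ι) : ENNReal.ofReal (a j / ∑ i, a i) *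
      ∫⁻ p, g (fun i => (p.1 : ℝ) * (Pi.single j 1 : ι → ℝ) i + (1 - p.1) * p.2 i)
        ∂(stickLaw (∑ i, a i)).prod (dirichletMeasure a) =
      ∫⁻ x, ENNReal.ofReal (x j) * g x ∂dirichletMeasure a := by
    rw [lintegral_eval_mul_dirichletMeasure ha hs j hg, ← dirichletMeasure_stickStep ha hs j,
      lintegral_map hg (measurable_stickStep j)]
  simp only [h]
  rw [← lintegral_finsetSum _ fun j _ => by fun_prop]
  refine lintegral_congr_ae ?_
  filter_upwards [dirichletMeasure_ae_nonneg a, dirichletMeasure_ae_sum_eq_one hs] with x hx hx1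
  rw [← Finset.sum_mul, ← ENNReal.ofReal_sum_of_nonneg fun i _ => hx i, hx1, ENNReal.ofReal_one,
    one_mul]

/-- Size biasing a Dirichlet law by the monomial `∏ i, x (j i)`: the mixed moment factors out. -/
lemma exists_lintegral_prod_mul_dirichletMeasure {a : ι → ℝ} (ha : ∀ i, 0 ≤ a i)
    (hs : 0 < ∑ i, a i) {n : ℕ} (j : Fin n → ι) :
    ∃ c : ℝ≥0∞, ∀ g : (ι → ℝ) → ℝ≥0∞, Measurable g →
      ∫⁻ x, (∏ i, ENNReal.ofReal (x (j i))) * g x ∂dirichletMeasure a =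
        c * ∫⁻ x, g x ∂dirichletMeasure (a + ∑ i, Pi.single (j i) 1) := by
  induction n generalizing a with
  | zero => exact ⟨1, fun g _ => by simp⟩
  | succ n ih =>
    have ha' (i : ι) : 0 ≤ (a + Pi.single (j 0) 1 : ι → ℝ) i :=
      add_nonneg (ha i) (by rw [Pi.single_apply]; split_ifs <;> norm_num)
    have hs' : 0 < ∑ i, (a + Pi.single (j 0) 1 : ι → ℝ) i := by
      simp only [Pi.add_apply, Finset.sum_add_distrib]
      simpa using by linarith
    obtain ⟨c, hc⟩ := ih ha' hs' (fun i => j i.succ)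
    refine ⟨ENNReal.ofReal (a (j 0) / ∑ i, a i) * c, fun g hg => ?_⟩
    simp only [Fin.prod_univ_succ, Fin.sum_univ_succ, mul_assoc]
    rw [lintegral_eval_mul_dirichletMeasure ha hs (j 0) (by fun_prop), hc g hg, add_assoc]

end

/-! ### Stick-breaking -/

/-- Resampling one term of an i.i.d. sequence does not change its law. This is how independence of
the terms is used below. -/
lemma map_update_infinitePi {U : Type*} [MeasurableSpace U] (ν : Measure U)
    [IsProbabilityMeasure ν] (n : ℕ) :
    ((Measure.infinitePi fun _ : ℕ => ν).prod ν).map (fun q => Function.update q.1 n q.2) =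
      Measure.infinitePi fun _ : ℕ => ν := by
  refine Measure.eq_infinitePi _ fun s t ht => ?_
  have hupd : Measurable fun q : (ℕ → U) × U => Function.update q.1 n q.2 := by
    refine measurable_pi_lambda _ fun i => ?_
    rcases eq_or_ne i n with rfl | hi
    · simp only [Function.update_self]; fun_prop
    · simp only [Function.update_of_ne hi]; fun_prop
  have hpre : (fun q : (ℕ → U) × U => Function.update q.1 n q.2) ⁻¹' Set.pi s t =
      Set.pi (s.erase n : Finset ℕ) t ×ˢ (if n ∈ s then t n else Set.univ) := by
    ext q
    simp only [Set.mem_preimage, Set.mem_pi, Finset.mem_coe, Set.mem_prod, Finset.mem_erase]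
    constructor
    · intro h
      refine ⟨fun i hi => by simpa [hi.1] using h i hi.2, ?_⟩
      split_ifs with hn
      · simpa using h n hn
      · trivial
    · rintro ⟨h1, h2⟩ i hi
      rcases eq_or_ne i n with rfl | hin
      · simpa [hi] using h2
      · simpa [hin] using h1 i ⟨hin, hi⟩
  rw [Measure.map_apply hupd (MeasurableSet.pi s.countable_toSet fun i _ => ht i), hpre,
    Measure.prod_prod, Measure.infinitePi_pi _ fun i _ => ht i]
  split_ifs with hn
  · rw [mul_comm, Finset.mul_prod_erase s (fun i => ν (t i)) hn]
  · rw [measure_univ, mul_one, Finset.erase_eq_of_notMem hn]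

section

variable {𝕏 : Type*}

/-- The length of stick left after `n` breaks, where the `k`-th break takes the proportion
`(u k).1` of what is left. -/
def stickRest (u : ℕ → unitInterval × 𝕏) (n : ℕ) : ℝ :=
  ∏ k ∈ Finset.range n, (1 - ((u k).1 : ℝ))

/-- The length of the `k`-th piece of stick. -/
def stickWeight (u : ℕ → unitInterval × 𝕏) (k : ℕ) : ℝ := (u k).1 * stickRest u k

lemma stickRest_succ (u : ℕ → unitInterval × 𝕏) (n : ℕ) :
    stickRest u (n + 1) = stickRest u n * (1 - (u n).1) := Finset.prod_range_succ _ _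

lemma stickRest_nonneg (u : ℕ → unitInterval × 𝕏) (n : ℕ) : 0 ≤ stickRest u n :=
  Finset.prod_nonneg fun k _ => sub_nonneg.2 (u k).1.2.2

lemma antitone_stickRest (u : ℕ → unitInterval × 𝕏) : Antitone (stickRest u) := by
  refine antitone_nat_of_succ_le fun n => ?_
  rw [stickRest_succ]
  exact mul_le_of_le_one_right (stickRest_nonneg u n) (by linarith [(u n).1.2.1])

lemma stickWeight_nonneg (u : ℕ → unitInterval × 𝕏) (n : ℕ) : 0 ≤ stickWeight u n :=
  mul_nonneg (u n).1.2.1 (stickRest_nonneg u n)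

lemma sum_stickWeight (u : ℕ → unitInterval × 𝕏) (n : ℕ) :
    ∑ k ∈ Finset.range n, stickWeight u k = 1 - stickRest u n := by
  induction n with
  | zero => simp [stickRest]
  | succ n ih => rw [Finset.sum_range_succ, ih, stickRest_succ, stickWeight]; ring

lemma stickRest_congr {u u' : ℕ → unitInterval × 𝕏} {n : ℕ} (h : ∀ k < n, u k = u' k) :
    stickRest u n = stickRest u' n :=
  Finset.prod_congr rfl fun k hk => by rw [h k (Finset.mem_range.1 hk)]

lemma stickWeight_congr {u u' : ℕ → unitInterval × 𝕏} {n : ℕ} (h : ∀ k ≤ n, u k = u' k) :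
    stickWeight u n = stickWeight u' n := by
  rw [stickWeight, stickWeight, h n le_rfl, stickRest_congr fun k hk => h k hk.le]

lemma tsum_stickWeight_le_one (u : ℕ → unitInterval × 𝕏) :
    ∑' k, ENNReal.ofReal (stickWeight u k) ≤ 1 := by
  rw [ENNReal.tsum_eq_iSup_nat]
  refine iSup_le fun n => ?_
  rw [← ENNReal.ofReal_sum_of_nonneg fun k _ => stickWeight_nonneg u k, sum_stickWeight]
  exact ENNReal.ofReal_le_one.2 (by linarith [stickRest_nonneg u n])

variable [MeasurableSpace 𝕏]

@[fun_prop]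
lemma measurable_stickRest (n : ℕ) :
    Measurable fun u : ℕ → unitInterval × 𝕏 => stickRest u n := by
  unfold stickRest; fun_prop

@[fun_prop]
lemma measurable_stickWeight (n : ℕ) :
    Measurable fun u : ℕ → unitInterval × 𝕏 => stickWeight u n := by
  unfold stickWeight; fun_prop

/-- The discrete measure putting the pieces of stick at the points `(u k).2`. If the pieces do not
exhaust the stick, a null event for the sequences considered here, the remainder is put at
`(u 0).2`, so that the measure is always a probability measure. -/
noncomputable def stickMeasure (u : ℕ → unitInterval × 𝕏) : Measure 𝕏 :=
  Measure.sum (fun k => ENNReal.ofReal (stickWeight u k) • Measure.dirac (u k).2) +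
    (1 - ∑' k, ENNReal.ofReal (stickWeight u k)) • Measure.dirac (u 0).2

lemma stickMeasure_apply (u : ℕ → unitInterval × 𝕏) {B : Set 𝕏} (hB : MeasurableSet B) :
    stickMeasure u B = ∑' k, ENNReal.ofReal (stickWeight u k) * B.indicator 1 (u k).2 +
      (1 - ∑' k, ENNReal.ofReal (stickWeight u k)) * B.indicator 1 (u 0).2 := by
  simp [stickMeasure, Measure.sum_apply _ hB, Measure.dirac_apply' _ hB]

instance isProbabilityMeasure_stickMeasure (u : ℕ → unitInterval × 𝕏) :
    IsProbabilityMeasure (stickMeasure u) where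
  measure_univ := by
    rw [stickMeasure_apply u MeasurableSet.univ]
    simp [add_tsub_cancel_of_le (tsum_stickWeight_le_one u)]

lemma measurable_stickMeasure :
    Measurable (stickMeasure : (ℕ → unitInterval × 𝕏) → Measure 𝕏) := by
  refine Measure.measurable_of_measurable_coe _ fun B hB => ?_
  simp only [stickMeasure_apply _ hB]
  have hind (k : ℕ) : Measurable fun u : ℕ → unitInterval × 𝕏 =>
      B.indicator (1 : 𝕏 → ℝ≥0∞) (u k).2 :=
    (measurable_one.indicator hB).comp (by fun_prop)
  exact (Measurable.tsum fun k => by fun_prop).add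
    ((measurable_const.sub (Measurable.tsum fun k => by fun_prop)).mul (hind 0))

/-- The random probability measure obtained by stick-breaking. -/
noncomputable def stickProbability (u : ℕ → unitInterval × 𝕏) : ProbabilityMeasure 𝕏 :=
  ⟨stickMeasure u, isProbabilityMeasure_stickMeasure u⟩

lemma measurable_stickProbability :
    Measurable (stickProbability : (ℕ → unitInterval × 𝕏) → ProbabilityMeasure 𝕏) :=
  measurable_stickMeasure.subtype_mk

lemma sum_stickWeight_le_stickMeasure (u : ℕ → unitInterval × 𝕏) {B : Set 𝕏}
    (hB : MeasurableSet B) (n : ℕ) :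
    ∑ k ∈ Finset.range n, stickWeight u k * B.indicator 1 (u k).2 ≤ (stickMeasure u).real B := by
  have hnn (k : ℕ) : 0 ≤ stickWeight u k * B.indicator 1 (u k).2 :=
    mul_nonneg (stickWeight_nonneg u k) (Set.indicator_nonneg (by simp) _)
  rw [measureReal_def, ← ENNReal.ofReal_le_iff_le_toReal (measure_ne_top _ _),
    stickMeasure_apply u hB, ENNReal.ofReal_sum_of_nonneg fun k _ => hnn k]
  refine le_add_right (le_trans (le_of_eq ?_) (ENNReal.sum_le_tsum (Finset.range n)))
  refine Finset.sum_congr rfl fun k _ => ?_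
  rw [ENNReal.ofReal_mul (stickWeight_nonneg u k)]
  congr 1
  by_cases h : (u k).2 ∈ B <;> simp [h]

/-- The partial sums bound the mass of `B` from below, and those for `Bᶜ` bound it from above, so the
placement of a remainder of mass at `(u 0).2` never has to be examined. -/
lemma tendsto_sum_stickWeight {u : ℕ → unitInterval × 𝕏}
    (hu : Tendsto (stickRest u) atTop (𝓝 0)) {B : Set 𝕏} (hB : MeasurableSet B) :
    Tendsto (fun n => ∑ k ∈ Finset.range n, stickWeight u k * B.indicator 1 (u k).2) atTop
      (𝓝 ((stickMeasure u).real B)) := by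
  refine tendsto_of_tendsto_of_tendsto_of_le_of_le
    (g := fun n => (stickMeasure u).real B - stickRest u n)
    (by simpa using tendsto_const_nhds.sub hu) tendsto_const_nhds (fun n => ?_)
    (sum_stickWeight_le_stickMeasure u hB)
  have h1 := sum_stickWeight_le_stickMeasure u hB.compl n
  have h2 : ∑ k ∈ Finset.range n, stickWeight u k * B.indicator 1 (u k).2 +
      ∑ k ∈ Finset.range n, stickWeight u k * Bᶜ.indicator 1 (u k).2 = 1 - stickRest u n := by
    rw [← Finset.sum_add_distrib, ← sum_stickWeight]
    refine Finset.sum_congr rfl fun k _ => ?_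
    by_cases h : (u k).2 ∈ B <;> simp [h]
  rw [probReal_compl_eq_one_sub hB] at h1
  simp only
  linarith

/-- The law of the sequence of proportions and locations used in stick-breaking. -/
noncomputable abbrev stickSequence (s : ℝ) (α : Measure 𝕏) : Measure (ℕ → unitInterval × 𝕏) :=
  Measure.infinitePi fun _ => (stickLaw s).prod α

variable (s : ℝ) (α : Measure 𝕏) [IsProbabilityMeasure α]

lemma lintegral_stickSequence_update {F : (ℕ → unitInterval × 𝕏) → ℝ≥0∞} (hF : Measurable F)
    (n : ℕ) : ∫⁻ u, F u ∂stickSequence s α =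
      ∫⁻ u, ∫⁻ p, F (Function.update u n p) ∂(stickLaw s).prod α ∂stickSequence s α := by
  have hupd : Measurable fun q : (ℕ → unitInterval × 𝕏) × (unitInterval × 𝕏) =>
      Function.update q.1 n q.2 := by
    refine measurable_pi_lambda _ fun i => ?_
    rcases eq_or_ne i n with rfl | hi
    · simp only [Function.update_self]; fun_prop
    · simp only [Function.update_of_ne hi]; fun_prop
  conv_lhs => rw [stickSequence, ← map_update_infinitePi _ n]
  rw [lintegral_map hF hupd]
  exact lintegral_prod _ (hF.comp hupd).aemeasurable

lemma lintegral_stickRest (n : ℕ) :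
    ∫⁻ u, ENNReal.ofReal (stickRest u n) ∂stickSequence s α =
      (∫⁻ v : unitInterval, ENNReal.ofReal (1 - v) ∂stickLaw s) ^ n := by
  induction n with
  | zero => simp [stickRest]
  | succ n ih =>
    have hfst : ∫⁻ p, ENNReal.ofReal (1 - (p.1 : ℝ)) ∂(stickLaw s).prod α =
        ∫⁻ v : unitInterval, ENNReal.ofReal (1 - v) ∂stickLaw s := by
      rw [lintegral_prod _ (by fun_prop)]
      simp
    have hstep (u : ℕ → unitInterval × 𝕏) :
        ∫⁻ p, ENNReal.ofReal (stickRest (Function.update u n p) (n + 1)) ∂(stickLaw s).prod α =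
          ENNReal.ofReal (stickRest u n) *
            ∫⁻ v : unitInterval, ENNReal.ofReal (1 - v) ∂stickLaw s := by
      rw [← hfst, ← lintegral_const_mul _ (by fun_prop)]
      refine lintegral_congr fun p => ?_
      rw [stickRest_succ, Function.update_self, stickRest_congr (u' := u)
        fun k hk => Function.update_of_ne hk.ne _ _, ENNReal.ofReal_mul (stickRest_nonneg u n)]
    rw [lintegral_stickSequence_update s α (by fun_prop) n]
    simp only [hstep]
    rw [lintegral_mul_const _ (by fun_prop), ih, pow_succ]

/-- The remainders decrease, and their means are the powers of a number less than `1`. -/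
lemma ae_tendsto_stickRest :
    ∀ᵐ u ∂stickSequence s α, Tendsto (stickRest u) atTop (𝓝 0) := by
  have hc : ∫⁻ v : unitInterval, ENNReal.ofReal (1 - v) ∂stickLaw s < 1 := by
    have h1 : ∫⁻ _ : unitInterval, (1 : ℝ≥0∞) ∂stickLaw s = 1 := by simp
    have hle : ∫⁻ v : unitInterval, ENNReal.ofReal (1 - v) ∂stickLaw s ≤ 1 := by
      rw [← h1]
      exact lintegral_mono fun v => ENNReal.ofReal_le_one.2 (by linarith [v.2.1])
    rw [← h1]
    refine lintegral_strict_mono (IsProbabilityMeasure.ne_zero _) (by fun_prop)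
      (hle.trans_lt ENNReal.one_lt_top).ne ?_
    filter_upwards [stickLaw_ae_pos s] with v hv
    rw [ENNReal.ofReal_lt_one]
    linarith
  have hinf : ∫⁻ u, ⨅ n, ENNReal.ofReal (stickRest u n) ∂stickSequence s α = 0 := by
    refine le_antisymm (ge_of_tendsto' (ENNReal.tendsto_pow_atTop_nhds_zero_of_lt_one hc)
      fun n => ?_) zero_le
    rw [← lintegral_stickRest s α n]
    exact lintegral_mono fun u => iInf_le _ n
  rw [lintegral_eq_zero_iff (Measurable.iInf fun n => by fun_prop)] at hinf
  filter_upwards [hinf] with u hu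
  have h := tendsto_atTop_iInf (f := fun n => ENNReal.ofReal (stickRest u n))
    fun m n hmn => ENNReal.ofReal_le_ofReal (antitone_stickRest u hmn)
  rw [hu] at h
  have h2 := (ENNReal.tendsto_toReal ENNReal.zero_ne_top).comp h
  simpa [Function.comp_def, ENNReal.toReal_ofReal (stickRest_nonneg u _)] using h2

end

/-! ### Existence of the Dirichlet process -/

section

variable {𝕏 : Type*} {m : ℕ} {B : Fin m → Set 𝕏}

lemma indicator_eq_single_of_mem (hd : Pairwise fun i j => Disjoint (B i) (B j)) {j : Fin m}
    {y : 𝕏} (hy : y ∈ B j) (i : Fin m) :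
    (B i).indicator (1 : 𝕏 → ℝ) y = (Pi.single j 1 : Fin m → ℝ) i := by
  rcases eq_or_ne i j with rfl | hij
  · simp [hy]
  · rw [Set.indicator_of_notMem (Set.disjoint_right.1 (hd hij) hy), Pi.single_eq_of_ne hij]

/-- The vector of masses that the first `n` pieces of stick give to the sets `B i`, when the
remainder of the stick is shared out according to `d`. -/
noncomputable def stickPartial (B : Fin m → Set 𝕏) (u : ℕ → unitInterval × 𝕏) (n : ℕ)
    (d : Fin m → ℝ) (i : Fin m) : ℝ :=
  ∑ k ∈ Finset.range n, stickWeight u k * (B i).indicator 1 (u k).2 + stickRest u n * d i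

lemma stickPartial_succ (B : Fin m → Set 𝕏) (u : ℕ → unitInterval × 𝕏) (n : ℕ)
    (d : Fin m → ℝ) : stickPartial B u (n + 1) d = stickPartial B u n fun i =>
      ((u n).1 : ℝ) * (B i).indicator 1 (u n).2 + (1 - (u n).1) * d i := by
  ext i
  simp only [stickPartial]
  rw [Finset.sum_range_succ, stickRest_succ, stickWeight]
  ring

lemma stickPartial_update (B : Fin m → Set 𝕏) (u : ℕ → unitInterval × 𝕏) (n : ℕ)
    (p : unitInterval × 𝕏) (d : Fin m → ℝ) :
    stickPartial B (Function.update u n p) n d = stickPartial B u n d := by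
  have h (k : ℕ) (hk : k < n) : Function.update u n p k = u k := Function.update_of_ne hk.ne _ _
  ext i
  simp only [stickPartial, stickRest_congr h]
  congr 1
  refine Finset.sum_congr rfl fun k hk => ?_
  have hk := Finset.mem_range.1 hk
  rw [h k hk, stickWeight_congr fun l hl => h l (hl.trans_lt hk)]

variable [MeasurableSpace 𝕏]

lemma sum_measureReal_partition (β : Measure 𝕏) [IsFiniteMeasure β]
    (hB : ∀ i, MeasurableSet (B i)) (hd : Pairwise fun i j => Disjoint (B i) (B j))
    (hu : (⋃ i, B i) = Set.univ) : ∑ i, β.real (B i) = β.real Set.univ := by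
  rw [← hu, measureReal_iUnion_fintype hd hB]

lemma lintegral_eq_sum_partition (μ : Measure 𝕏) (hB : ∀ i, MeasurableSet (B i))
    (hd : Pairwise fun i j => Disjoint (B i) (B j)) (hu : (⋃ i, B i) = Set.univ)
    {H : 𝕏 → ℝ≥0∞} {h : Fin m → ℝ≥0∞} (hH : ∀ i, ∀ y ∈ B i, H y = h i) :
    ∫⁻ y, H y ∂μ = ∑ i, μ (B i) * h i := by
  rw [← setLIntegral_univ, ← hu, lintegral_iUnion hB hd, tsum_fintype]
  refine Finset.sum_congr rfl fun i _ => ?_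
  rw [setLIntegral_congr_fun (hB i) (hH i), setLIntegral_const, mul_comm]

lemma measurable_stickPartial (hB : ∀ i, MeasurableSet (B i)) (n : ℕ) :
    Measurable fun q : (ℕ → unitInterval × 𝕏) × (Fin m → ℝ) => stickPartial B q.1 n q.2 := by
  refine measurable_pi_lambda _ fun i => ?_
  have hind (k : ℕ) : Measurable fun q : (ℕ → unitInterval × 𝕏) × (Fin m → ℝ) =>
      (B i).indicator (1 : 𝕏 → ℝ) (q.1 k).2 :=
    (measurable_one.indicator (hB i)).comp (by fun_prop)
  unfold stickPartial
  exact (Finset.measurable_fun_sum _ fun k _ =>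
    ((measurable_stickWeight k).comp measurable_fst).mul (hind k)).add
    (((measurable_stickRest n).comp measurable_fst).mul (by fun_prop))

variable {α : Measure 𝕏} [IsProbabilityMeasure α] {a : Fin m → ℝ}

/-- The fixed-point equation `sum_lintegral_stickStep`, with the random vertex realized as the cell
of the partition that contains a point of law `α`. -/
lemma lintegral_stickLaw_prod_dirichletMeasure (hB : ∀ i, MeasurableSet (B i))
    (hd : Pairwise fun i j => Disjoint (B i) (B j)) (hu : (⋃ i, B i) = Set.univ)
    (ha : ∀ i, 0 ≤ a i) (hs : 0 < ∑ i, a i)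
    (hα : ∀ j, α (B j) = ENNReal.ofReal (a j / ∑ i, a i)) {g : (Fin m → ℝ) → ℝ≥0∞}
    (hg : Measurable g) :
    ∫⁻ p, ∫⁻ d, g (fun i => (p.1 : ℝ) * (B i).indicator 1 p.2 + (1 - p.1) * d i)
        ∂dirichletMeasure a ∂(stickLaw (∑ i, a i)).prod α =
      ∫⁻ x, g x ∂dirichletMeasure a := by
  have hm : Measurable fun q : (unitInterval × 𝕏) × (Fin m → ℝ) =>
      g fun i => (q.1.1 : ℝ) * (B i).indicator 1 q.1.2 + (1 - q.1.1) * q.2 i := by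
    refine hg.comp (measurable_pi_lambda _ fun i => ?_)
    have hind : Measurable fun q : (unitInterval × 𝕏) × (Fin m → ℝ) =>
        (B i).indicator (1 : 𝕏 → ℝ) q.1.2 :=
      (measurable_one.indicator (hB i)).comp (by fun_prop)
    fun_prop
  rw [lintegral_prod_symm _ hm.lintegral_prod_right'.aemeasurable,
    lintegral_eq_sum_partition α hB hd hu (h := fun j =>
      ∫⁻ p, g (fun i => (p.1 : ℝ) * (Pi.single j 1 : Fin m → ℝ) i + (1 - p.1) * p.2 i)
        ∂(stickLaw (∑ i, a i)).prod (dirichletMeasure a)) fun j y hy => ?_]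
  · simp only [hα]
    exact sum_lintegral_stickStep ha hs hg
  · simp only [indicator_eq_single_of_mem hd hy]
    exact (lintegral_prod _ (hg.comp (measurable_stickStep j)).aemeasurable).symm

/-- If `d` is Dirichlet, so is `stickPartial B u n d` for every `n`, by induction: breaking off the
next piece replaces `d` by a mixture of `d` with a random vertex, which has the same law. -/
lemma lintegral_stickPartial (hB : ∀ i, MeasurableSet (B i))
    (hd : Pairwise fun i j => Disjoint (B i) (B j)) (hu : (⋃ i, B i) = Set.univ)
    (ha : ∀ i, 0 ≤ a i) (hs : 0 < ∑ i, a i)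
    (hα : ∀ j, α (B j) = ENNReal.ofReal (a j / ∑ i, a i)) {g : (Fin m → ℝ) → ℝ≥0∞}
    (hg : Measurable g) (n : ℕ) :
    ∫⁻ u, ∫⁻ d, g (stickPartial B u n d) ∂dirichletMeasure a ∂stickSequence (∑ i, a i) α =
      ∫⁻ x, g x ∂dirichletMeasure a := by
  induction n with
  | zero =>
    have h0 (u : ℕ → unitInterval × 𝕏) (d : Fin m → ℝ) : stickPartial B u 0 d = d := by
      ext i; simp [stickPartial, stickRest]
    simp [h0]
  | succ n ih =>
    have hm (n : ℕ) : Measurable fun u =>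
        ∫⁻ d, g (stickPartial B u n d) ∂dirichletMeasure a := (hg.comp (measurable_stickPartial hB n)).lintegral_prod_right'
      (ν := dirichletMeasure a)
    rw [lintegral_stickSequence_update _ _ (hm (n + 1)) n, ← ih]
    refine lintegral_congr fun u => ?_
    simp only [stickPartial_succ, stickPartial_update, Function.update_self]
    exact lintegral_stickLaw_prod_dirichletMeasure hB hd hu ha hs hα
      (g := fun d => g (stickPartial B u n d))
      (hg.comp ((measurable_stickPartial hB n).comp measurable_prodMk_left))

lemma measurable_measureReal {ι : Type*} {A : ι → Set 𝕏} (hA : ∀ i, MeasurableSet (A i)) :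
    Measurable fun (P : ProbabilityMeasure 𝕏) i => (P : Measure 𝕏).real (A i) :=
  measurable_pi_lambda _ fun i =>
    ((Measure.measurable_coe (hA i)).comp measurable_subtype_coe).ennreal_toReal

/-- Stick-breaking produces the Dirichlet distributions: the vectors `stickPartial B u n d` with
`d` Dirichlet all have this Dirichlet law, and they converge to the masses of the sets `B i`. -/
lemma map_stickProbability_partition (hB : ∀ i, MeasurableSet (B i))
    (hd : Pairwise fun i j => Disjoint (B i) (B j)) (hu : (⋃ i, B i) = Set.univ)
    (ha : ∀ i, 0 ≤ a i) (hs : 0 < ∑ i, a i)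
    (hα : ∀ j, α (B j) = ENNReal.ofReal (a j / ∑ i, a i)) :
    (stickSequence (∑ i, a i) α).map
      (fun u i => (stickProbability u : Measure 𝕏).real (B i)) = dirichletMeasure a := by
  have hmeas : Measurable fun (u : ℕ → unitInterval × 𝕏) i =>
      (stickProbability u : Measure 𝕏).real (B i) :=
    (measurable_measureReal hB).comp measurable_stickProbability
  have : IsProbabilityMeasure ((stickSequence (∑ i, a i) α).map
      fun u i => (stickProbability u : Measure 𝕏).real (B i)) :=
    Measure.isProbabilityMeasure_map hmeas.aemeasurable
  refine ext_of_forall_lintegral_eq_of_IsFiniteMeasure fun g => ?_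
  have hg : Measurable fun x => (g x : ℝ≥0∞) := g.continuous.measurable.coe_nnreal_ennreal
  rw [lintegral_map hg hmeas]
  have hlim : Tendsto (fun n => ∫⁻ q, (g (stickPartial B q.1 n q.2) : ℝ≥0∞)
        ∂(stickSequence (∑ i, a i) α).prod (dirichletMeasure a)) atTop
      (𝓝 (∫⁻ q, (g fun i => (stickProbability q.1 : Measure 𝕏).real (B i) : ℝ≥0∞)
        ∂(stickSequence (∑ i, a i) α).prod (dirichletMeasure a))) := by
    refine tendsto_lintegral_of_dominated_convergence (fun _ => (nndist g 0 : ℝ≥0∞))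
      (fun n => hg.comp (measurable_stickPartial hB n)) (fun n => ae_of_all _ fun q => ?_)
      (by simp) ?_
    · exact ENNReal.coe_le_coe.2 (BoundedContinuousFunction.NNReal.upper_bound g _)
    · filter_upwards [Measure.quasiMeasurePreserving_fst.ae
        (ae_tendsto_stickRest (∑ i, a i) α)] with q hq
      refine (ENNReal.continuous_coe.comp g.continuous).continuousAt.tendsto.comp ?_
      refine tendsto_pi_nhds.2 fun i => ?_
      have h := (tendsto_sum_stickWeight hq (hB i)).add (hq.mul_const (q.2 i))
      rwa [zero_mul, add_zero] at h
  have hconst (n : ℕ) : ∫⁻ q, (g (stickPartial B q.1 n q.2) : ℝ≥0∞)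
      ∂(stickSequence (∑ i, a i) α).prod (dirichletMeasure a) =
        ∫⁻ x, g x ∂dirichletMeasure a := by
    rw [← lintegral_stickPartial hB hd hu ha hs hα hg n]
    exact lintegral_prod _ (hg.comp (measurable_stickPartial hB n)).aemeasurable
  simp only [hconst] at hlim
  rw [tendsto_nhds_unique tendsto_const_nhds hlim]
  refine Eq.trans ?_ (lintegral_prod _ ((hg.comp hmeas).comp measurable_fst).aemeasurable).symm
  simp

lemma exists_isDirichletProcess (β : Measure 𝕏) [IsFiniteMeasure β] (hβ : β ≠ 0) :
    ∃ μ, IsDirichletProcess β μ := by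
  have hne : β Set.univ ≠ 0 := by simpa using hβ
  have hα : IsProbabilityMeasure ((β Set.univ)⁻¹ • β) := by
    constructor
    simp [ENNReal.inv_mul_cancel hne (measure_ne_top _ _)]
  refine ⟨(stickSequence (β.real Set.univ) ((β Set.univ)⁻¹ • β)).map stickProbability,
    Measure.isProbabilityMeasure_map measurable_stickProbability.aemeasurable,
    fun m B hB hd hu => ?_⟩
  have hsum := sum_measureReal_partition β hB hd hu
  have hpos : 0 < β.real Set.univ := ENNReal.toReal_pos hne (measure_ne_top _ _)
  rw [Measure.map_map (measurable_measureReal hB) measurable_stickProbability, ← hsum]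
  refine map_stickProbability_partition hB hd hu (fun i => measureReal_nonneg) (hsum ▸ hpos)
    fun j => ?_
  rw [hsum, ENNReal.ofReal_div_of_pos hpos, ofReal_measureReal, ofReal_measureReal,
    Measure.smul_apply, smul_eq_mul, ENNReal.div_eq_inv_mul]

end

/-! ### Cylinder sets of probability measures, and uniqueness -/

section

variable {𝕏 : Type*} [MeasurableSpace 𝕏]

/-- `B` is a finite measurable partition; its members may be empty. -/
structure IsMeasurablePartition {m : ℕ} (B : Fin m → Set 𝕏) : Prop where
  measurableSet : ∀ i, MeasurableSet (B i)
  pairwise_disjoint : Pairwise fun i j => Disjoint (B i) (B j)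
  iUnion_eq : (⋃ i, B i) = Set.univ

/-- The masses that a probability measure gives to the members of a family of sets. -/
noncomputable def massVector {ι : Type*} (A : ι → Set 𝕏) (P : ProbabilityMeasure 𝕏) (i : ι) : ℝ :=
  (P : Measure 𝕏).real (A i)

lemma measurable_massVector {ι : Type*} {A : ι → Set 𝕏} (hA : ∀ i, MeasurableSet (A i)) :
    Measurable (massVector A) :=
  measurable_measureReal hA

/-- Each point lies in one cell of a partition, which depends measurably on the point. -/
lemma IsMeasurablePartition.exists_index {m : ℕ} {B : Fin m → Set 𝕏}
    (hB : IsMeasurablePartition B) :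
    ∃ c : 𝕏 → Fin m, Measurable c ∧ ∀ y j, y ∈ B j ↔ c y = j := by
  have hex (y : 𝕏) : ∃ j, y ∈ B j := by
    rw [← Set.mem_iUnion, hB.iUnion_eq]
    trivial
  choose c hc using hex
  have hiff (y : 𝕏) (j : Fin m) : y ∈ B j ↔ c y = j := by
    refine ⟨fun hy => ?_, fun h => h ▸ hc y⟩
    by_contra hne
    exact Set.disjoint_left.1 (hB.pairwise_disjoint hne) (hc y) hy
  refine ⟨c, measurable_to_countable' fun j => ?_, hiff⟩
  convert hB.measurableSet j using 1
  ext y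
  simp [hiff]

/-- Any finite family of measurable sets is refined by the partition into its atoms. -/
lemma exists_partition_refining {ι : Type*} [Finite ι] {A : ι → Set 𝕏}
    (hA : ∀ i, MeasurableSet (A i)) :
    ∃ (m : ℕ) (B : Fin m → Set 𝕏) (I : ι → Finset (Fin m)), IsMeasurablePartition B ∧
      ∀ i, A i = ⋃ j ∈ I i, B j := by
  classical
  have := Fintype.ofFinite ι
  let e : (ι → Prop) ≃ Fin (Fintype.card (ι → Prop)) := Fintype.equivFin _
  let atom (y : 𝕏) : ι → Prop := fun i => y ∈ A i
  have hatom : Measurable atom := measurable_pi_lambda _ fun i => (hA i).mem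
  refine ⟨_, fun j => atom ⁻¹' {e.symm j}, fun i => Finset.univ.filter fun j => e.symm j i,
    ⟨fun j => hatom (measurableSet_singleton _), fun j k hjk => ?_, ?_⟩, fun i => ?_⟩
  · refine Set.disjoint_left.2 fun y hj hk => hjk (e.symm.injective ?_)
    exact (Set.mem_singleton_iff.1 hj).symm.trans hk
  · exact Set.eq_univ_of_forall fun y => Set.mem_iUnion.2 ⟨e (atom y), by simp⟩
  · ext y
    simp only [Finset.mem_filter, Finset.mem_univ, true_and, Set.mem_iUnion, Set.mem_preimage,
      Set.mem_singleton_iff, exists_prop]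
    exact ⟨fun h => ⟨e (atom y), by simpa [atom] using h, by simp⟩,
      fun ⟨j, h1, h2⟩ => by rw [← h2] at h1; exact h1⟩

lemma massVector_eq_sum {ι : Type*} {m : ℕ} {A : ι → Set 𝕏} {B : Fin m → Set 𝕏}
    {I : ι → Finset (Fin m)} (hB : IsMeasurablePartition B) (hI : ∀ i, A i = ⋃ j ∈ I i, B j)
    (P : ProbabilityMeasure 𝕏) (i : ι) : massVector A P i = ∑ j ∈ I i, massVector B P j := by
  simp only [massVector]
  rw [hI i, measureReal_biUnion_finset (fun j _ k _ hjk => hB.pairwise_disjoint hjk)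
    fun j _ => hB.measurableSet j]

variable (𝕏) in
/-- The sets of probability measures that are described by the masses of the cells of a finite
measurable partition. -/
def cylinderSets : Set (Set (ProbabilityMeasure 𝕏)) :=
  {C | ∃ (m : ℕ) (B : Fin m → Set 𝕏) (T : Set (Fin m → ℝ)), IsMeasurablePartition B ∧
    MeasurableSet T ∧ C = massVector B ⁻¹' T}

/-- Events about the masses of finitely many sets are cylinder sets, and can be written with a
partition refining any further finite family of sets. -/
lemma exists_partition_massVector {ι ι' : Type*} [Finite ι] [Finite ι'] {A : ι → Set 𝕏}
    {A' : ι' → Set 𝕏} (hA : ∀ i, MeasurableSet (A i)) (hA' : ∀ i, MeasurableSet (A' i))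
    {T : Set (ι → ℝ)} (hT : MeasurableSet T) :
    ∃ (m : ℕ) (B : Fin m → Set 𝕏) (I : ι' → Finset (Fin m)) (T' : Set (Fin m → ℝ)),
      IsMeasurablePartition B ∧ (∀ i, A' i = ⋃ j ∈ I i, B j) ∧ MeasurableSet T' ∧
        massVector A ⁻¹' T = massVector B ⁻¹' T' := by
  obtain ⟨m, B, I, hB, hI⟩ := exists_partition_refining (A := Sum.elim A A')
    (by rintro (i | i); exacts [hA i, hA' i])
  refine ⟨m, B, fun i => I (Sum.inr i), (fun b i => ∑ j ∈ I (Sum.inl i), b j) ⁻¹' T, hB,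
    fun i => hI (Sum.inr i), (by fun_prop : Measurable _) hT, ?_⟩
  rw [← Set.preimage_comp]
  congr 1
  ext P i
  exact massVector_eq_sum hB hI P (Sum.inl i)

lemma massVector_preimage_mem_cylinderSets {ι : Type*} [Finite ι] {A : ι → Set 𝕏}
    (hA : ∀ i, MeasurableSet (A i)) {T : Set (ι → ℝ)} (hT : MeasurableSet T) :
    massVector A ⁻¹' T ∈ cylinderSets 𝕏 := by
  obtain ⟨m, B, -, T', hB, -, hT', h⟩ :=
    exists_partition_massVector (A' := fun i : Empty => i.elim) hA (fun i => i.elim) hT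
  exact ⟨m, B, T', hB, hT', h⟩

lemma isPiSystem_cylinderSets : IsPiSystem (cylinderSets 𝕏) := by
  rintro _ ⟨m, B, T, hB, hT, rfl⟩ _ ⟨m', B', T', hB', hT', rfl⟩ -
  have h := massVector_preimage_mem_cylinderSets (A := Sum.elim B B')
    (by rintro (i | i); exacts [hB.measurableSet i, hB'.measurableSet i])
    (T := {b | (fun i => b (Sum.inl i)) ∈ T ∧ (fun i => b (Sum.inr i)) ∈ T'})
    (((by fun_prop : Measurable fun (b : Fin m ⊕ Fin m' → ℝ) i => b (Sum.inl i)) hT).inter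
      ((by fun_prop : Measurable fun (b : Fin m ⊕ Fin m' → ℝ) i => b (Sum.inr i)) hT'))
  exact h

lemma univ_mem_cylinderSets : Set.univ ∈ cylinderSets 𝕏 := by
  simpa using massVector_preimage_mem_cylinderSets (A := fun i : Empty => (i.elim : Set 𝕏))
    (fun i => i.elim) MeasurableSet.univ

lemma measurableSet_of_mem_cylinderSets {C : Set (ProbabilityMeasure 𝕏)}
    (hC : C ∈ cylinderSets 𝕏) : MeasurableSet C := by
  obtain ⟨m, B, T, hB, hT, rfl⟩ := hC
  exact measurable_massVector hB.measurableSet hT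

lemma generateFrom_cylinderSets :
    (inferInstance : MeasurableSpace (ProbabilityMeasure 𝕏)) =
      MeasurableSpace.generateFrom (cylinderSets 𝕏) := by
  refine le_antisymm ?_
    (MeasurableSpace.generateFrom_le fun C hC => measurableSet_of_mem_cylinderSets hC)
  have h : Measurable[MeasurableSpace.generateFrom (cylinderSets 𝕏)]
      (fun P : ProbabilityMeasure 𝕏 => (P : Measure 𝕏)) := by
    refine @Measure.measurable_of_measurable_coe _ _ _
      (MeasurableSpace.generateFrom (cylinderSets 𝕏)) _ fun A hA T hT => ?_
    refine MeasurableSpace.measurableSet_generateFrom ?_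
    convert massVector_preimage_mem_cylinderSets (A := fun _ : Unit => A) (fun _ => hA)
      (T := {b | ENNReal.ofReal (b ()) ∈ T})
      ((by fun_prop : Measurable fun b : Unit → ℝ => ENNReal.ofReal (b ())) hT) using 1
    ext P
    simp only [Set.mem_preimage, massVector, Set.mem_ofPred_eq]
    rw [ofReal_measureReal]
  exact h.comap_le

lemma IsDirichletProcess.map_massVector {β : Measure 𝕏} {μ : Measure (ProbabilityMeasure 𝕏)}
    (h : IsDirichletProcess β μ) {m : ℕ} {B : Fin m → Set 𝕏} (hB : IsMeasurablePartition B) :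
    μ.map (massVector B) = dirichletMeasure fun i => β.real (B i) :=
  h.map_partition m B hB.measurableSet hB.pairwise_disjoint hB.iUnion_eq

lemma IsDirichletProcess.massVector_preimage {β : Measure 𝕏}
    {μ : Measure (ProbabilityMeasure 𝕏)} (h : IsDirichletProcess β μ) {m : ℕ}
    {B : Fin m → Set 𝕏} (hB : IsMeasurablePartition B) {T : Set (Fin m → ℝ)}
    (hT : MeasurableSet T) :
    μ (massVector B ⁻¹' T) = dirichletMeasure (fun i => β.real (B i)) T := by
  rw [← h.map_massVector hB, Measure.map_apply (measurable_massVector hB.measurableSet) hT]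

lemma IsDirichletProcess.unique {β : Measure 𝕏} {μ ν : Measure (ProbabilityMeasure 𝕏)}
    (hμ : IsDirichletProcess β μ) (hν : IsDirichletProcess β ν) : μ = ν := by
  have := hμ.isProbabilityMeasure
  have := hν.isProbabilityMeasure
  refine ext_of_generate_finite _ generateFrom_cylinderSets isPiSystem_cylinderSets ?_ (by simp)
  rintro _ ⟨m, B, T, hB, hT, rfl⟩
  rw [hμ.massVector_preimage hB hT, hν.massVector_preimage hB hT]

lemma isDirichletProcess_dirichletProcess (β : Measure 𝕏) [IsFiniteMeasure β] (hβ : β ≠ 0) :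
    IsDirichletProcess β (dirichletProcess β) := by
  have h := exists_isDirichletProcess β hβ
  rw [dirichletProcess, dif_pos h]
  exact h.choose_spec

end

/-! ### The posterior law -/

section

variable {𝕏 : Type*} [MeasurableSpace 𝕏] {s : ℝ} (α : ProbabilityMeasure 𝕏)

instance isFiniteMeasure_posteriorBase {n : ℕ} (x : Fin n → 𝕏) :
    IsFiniteMeasure (ENNReal.ofReal s • (α : Measure 𝕏) + ∑ i, Measure.dirac (x i)) := by
  have := Measure.smul_finite (α : Measure 𝕏) (c := ENNReal.ofReal s) ENNReal.ofReal_ne_top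
  infer_instance

lemma posteriorBase_real (hs : 0 < s) {n : ℕ} (x : Fin n → 𝕏) {A : Set 𝕏}
    (hA : MeasurableSet A) :
    (ENNReal.ofReal s • (α : Measure 𝕏) + ∑ i, Measure.dirac (x i)).real A =
      s * (α : Measure 𝕏).real A + ∑ i, A.indicator 1 (x i) := by
  have h1 : ∑ i, (Measure.dirac (x i) : Measure 𝕏) A =
      ENNReal.ofReal (∑ i, A.indicator 1 (x i)) := by
    rw [ENNReal.ofReal_sum_of_nonneg fun i _ => Set.indicator_nonneg (by simp) _]
    refine Finset.sum_congr rfl fun i _ => ?_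
    rw [Measure.dirac_apply' _ hA]
    by_cases h : x i ∈ A <;> simp [h]
  have h2 : 0 ≤ ∑ i, A.indicator (1 : 𝕏 → ℝ) (x i) :=
    Finset.sum_nonneg fun i _ => Set.indicator_nonneg (by simp) _
  rw [measureReal_def, Measure.add_apply, Measure.smul_apply, Measure.finsetSum_apply, h1, smul_eq_mul,
    ENNReal.toReal_add (ENNReal.mul_ne_top ENNReal.ofReal_ne_top (measure_ne_top _ _))
      ENNReal.ofReal_ne_top, ENNReal.toReal_ofReal h2, ENNReal.toReal_mul,
    ENNReal.toReal_ofReal hs.le, measureReal_def]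

lemma posteriorBase_real_univ (hs : 0 < s) {n : ℕ} (x : Fin n → 𝕏) :
    (ENNReal.ofReal s • (α : Measure 𝕏) + ∑ i, Measure.dirac (x i)).real Set.univ = s + n := by
  rw [posteriorBase_real α hs x MeasurableSet.univ]
  simp

lemma posteriorBase_ne_zero (hs : 0 < s) {n : ℕ} (x : Fin n → 𝕏) :
    ENNReal.ofReal s • (α : Measure 𝕏) + ∑ i, Measure.dirac (x i) ≠ 0 := by
  intro h
  have h1 := posteriorBase_real_univ α hs x
  rw [h] at h1
  have : (0 : ℝ) < s + n := by positivity
  simp at h1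
  linarith

lemma isDirichletProcess_dpPosterior (hs : 0 < s) {n : ℕ} (x : Fin n → 𝕏) :
    IsDirichletProcess (ENNReal.ofReal s • (α : Measure 𝕏) + ∑ i, Measure.dirac (x i))
      (dpPosterior s α x) :=
  isDirichletProcess_dirichletProcess _ (posteriorBase_ne_zero α hs x)

lemma dpPosterior_finZero (x : Fin 0 → 𝕏) : dpPosterior s α x = dpPrior s α := by
  simp [dpPosterior, dpPrior]

/-- On the cells of a partition the posterior law only depends on the data through the cells the
observations fall in. -/
lemma dpPosterior_massVector_preimage (hs : 0 < s) {m : ℕ} {B : Fin m → Set 𝕏}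
    (hB : IsMeasurablePartition B) {T : Set (Fin m → ℝ)} (hT : MeasurableSet T) {n : ℕ}
    {x : Fin n → 𝕏} {j : Fin n → Fin m} (hx : ∀ i, x i ∈ B (j i)) :
    dpPosterior s α x (massVector B ⁻¹' T) =
      dirichletMeasure ((fun k => s * (α : Measure 𝕏).real (B k)) + ∑ i, Pi.single (j i) 1) T := by
  rw [(isDirichletProcess_dpPosterior α hs x).massVector_preimage hB hT]
  congr 2
  ext k
  rw [posteriorBase_real α hs x (hB.measurableSet k), Pi.add_apply, Finset.sum_apply]
  congr 1
  exact Finset.sum_congr rfl fun i _ =>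
    indicator_eq_single_of_mem hB.pairwise_disjoint (hx i) k

lemma dpPrior_map_massVector (hs : 0 < s) {m : ℕ} {B : Fin m → Set 𝕏}
    (hB : IsMeasurablePartition B) :
    (dpPrior s α).map (massVector B) =
      dirichletMeasure fun k => s * (α : Measure 𝕏).real (B k) := by
  rw [← dpPosterior_finZero α Fin.elim0,
    (isDirichletProcess_dpPosterior α hs Fin.elim0).map_massVector hB]
  congr 1
  ext k
  rw [posteriorBase_real α hs _ (hB.measurableSet k)]
  simp

lemma measurable_dpPosterior (hs : 0 < s) (n : ℕ) :
    Measurable fun x : Fin n → 𝕏 => dpPosterior s α x := by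
  have (x : Fin n → 𝕏) : IsProbabilityMeasure (dpPosterior s α x) :=
    (isDirichletProcess_dpPosterior α hs x).isProbabilityMeasure
  refine Measurable.measure_of_isPiSystem_of_isProbabilityMeasure generateFrom_cylinderSets
    isPiSystem_cylinderSets ?_
  rintro _ ⟨m, B, T, hB, hT, rfl⟩
  obtain ⟨c, hc, hcB⟩ := hB.exists_index
  have hcell (x : Fin n → 𝕏) := dpPosterior_massVector_preimage α hs hB hT
    (x := x) (j := fun i => c (x i)) fun i => (hcB _ _).2 rfl
  simp only [hcell]
  have hc' : Measurable fun (x : Fin n → 𝕏) i => c (x i) := by fun_prop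
  have hD : Measurable fun j : Fin n → Fin m => dirichletMeasure
      ((fun k => s * (α : Measure 𝕏).real (B k)) + ∑ i, Pi.single (j i) 1) T :=
    measurable_of_finite _
  exact hD.comp hc'

/-- The posterior law of the Dirichlet process, as a kernel from samples. -/
noncomputable def posteriorKernel (hs : 0 < s) (n : ℕ) :
    Kernel (Fin n → 𝕏) (ProbabilityMeasure 𝕏) :=
  ⟨fun x => dpPosterior s α x, measurable_dpPosterior α hs n⟩

instance isMarkovKernel_posteriorKernel (hs : 0 < s) (n : ℕ) :
    IsMarkovKernel (posteriorKernel α hs n) :=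
  ⟨fun x => (isDirichletProcess_dpPosterior α hs x).isProbabilityMeasure⟩

lemma IsIIDSample.measurable_sampleVector {Ω : Type*} [MeasurableSpace Ω] {ρ : Measure Ω}
    {P : Ω → ProbabilityMeasure 𝕏} {n : ℕ} {X : Fin n → Ω → 𝕏} (h : IsIIDSample ρ P X) :
    Measurable fun ω i => X i ω :=
  measurable_pi_lambda _ h.measurable_sample

/-- The joint law of the sample and the random measure on a product of cells with a cylinder set:
the mixed moment of the Dirichlet distribution factors, and its first factor does not depend on
the cylinder set. -/
lemma exists_measure_cell_inter {Ω : Type*} [MeasurableSpace Ω] {ρ : Measure Ω}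
    {P : Ω → ProbabilityMeasure 𝕏} {n : ℕ} {X : Fin n → Ω → 𝕏} (hs : 0 < s)
    (hP : HasLaw P (dpPrior s α) ρ) (h : IsIIDSample ρ P X) {m : ℕ} {B : Fin m → Set 𝕏}
    (hB : IsMeasurablePartition B) (j : Fin n → Fin m) :
    ∃ c : ℝ≥0∞, ∀ T : Set (Fin m → ℝ), MeasurableSet T →
      ρ {ω | P ω ∈ massVector B ⁻¹' T ∧ ∀ i, X i ω ∈ B (j i)} = c * dirichletMeasure
        ((fun k => s * (α : Measure 𝕏).real (B k)) + ∑ i, Pi.single (j i) 1) T := by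
  have ha (k : Fin m) : 0 ≤ s * (α : Measure 𝕏).real (B k) := by positivity
  have hsum : ∑ k, s * (α : Measure 𝕏).real (B k) = s := by
    rw [← Finset.mul_sum, sum_measureReal_partition _ hB.measurableSet hB.pairwise_disjoint
      hB.iUnion_eq]
    simp
  obtain ⟨c, hc⟩ := exists_lintegral_prod_mul_dirichletMeasure ha (by rwa [hsum]) j
  refine ⟨c, fun T hT => ?_⟩
  have hm := measurable_massVector hB.measurableSet
  have hF : Measurable fun x : Fin m → ℝ =>
      (∏ i, ENNReal.ofReal (x (j i))) * T.indicator 1 x :=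
    (Finset.measurable_fun_prod _ fun i _ => by fun_prop).mul (measurable_one.indicator hT)
  rw [h.measure_inter _ _ (hm hT) fun i => hB.measurableSet (j i),
    ← lintegral_indicator_one hT, ← hc _ (measurable_one.indicator hT),
    ← dpPrior_map_massVector α hs hB, lintegral_map hF hm, ← hP.map_eq,
    ← lintegral_indicator (h.measurable_law (hm hT))]
  refine Eq.trans ?_ (lintegral_map (hF.comp hm) h.measurable_law).symm
  refine lintegral_congr fun ω => ?_
  rw [Function.comp_apply]
  by_cases hω : massVector B (P ω) ∈ T
  · rw [Set.indicator_of_mem (by exact hω), Set.indicator_of_mem hω, Pi.one_apply, mul_one]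
    refine Finset.prod_congr rfl fun i _ => ?_
    rw [massVector, ofReal_measureReal]
  · rw [Set.indicator_of_notMem (by exact hω), Set.indicator_of_notMem hω, mul_zero]

lemma measure_cell_prod_massVector_preimage {Ω : Type*} [MeasurableSpace Ω] {ρ : Measure Ω}
    [IsProbabilityMeasure ρ] {P : Ω → ProbabilityMeasure 𝕏} {n : ℕ} {X : Fin n → Ω → 𝕏}
    (hs : 0 < s) (hP : HasLaw P (dpPrior s α) ρ) (h : IsIIDSample ρ P X) {m : ℕ}
    {B : Fin m → Set 𝕏} (hB : IsMeasurablePartition B) (j : Fin n → Fin m)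
    {T : Set (Fin m → ℝ)} (hT : MeasurableSet T) :
    ρ.map (fun ω => (fun i => X i ω, P ω))
        ((Set.univ.pi fun i => B (j i)) ×ˢ (massVector B ⁻¹' T)) =
      (ρ.map (fun ω i => X i ω) ⊗ₘ posteriorKernel α hs n)
        ((Set.univ.pi fun i => B (j i)) ×ˢ (massVector B ⁻¹' T)) := by
  obtain ⟨c, hc⟩ := exists_measure_cell_inter α hs hP h hB j
  have hcell : MeasurableSet (Set.univ.pi fun i => B (j i)) :=
    MeasurableSet.univ_pi fun i => hB.measurableSet (j i)
  have hC := measurable_massVector hB.measurableSet hT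
  have hX := h.measurable_sampleVector
  have hc1 : ρ.map (fun ω i => X i ω) (Set.univ.pi fun i => B (j i)) = c := by
    have := hc Set.univ MeasurableSet.univ
    rw [measure_univ, mul_one] at this
    rw [← this, Measure.map_apply hX hcell]
    congr 1
    ext ω
    simp
  have hconst : ∀ x ∈ Set.univ.pi fun i => B (j i),
      posteriorKernel α hs n x (massVector B ⁻¹' T) = dirichletMeasure
        ((fun k => s * (α : Measure 𝕏).real (B k)) + ∑ i, Pi.single (j i) 1) T := fun x hx =>
    dpPosterior_massVector_preimage α hs hB hT fun i => hx i trivial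
  rw [Measure.compProd_apply_prod hcell hC, setLIntegral_congr_fun hcell hconst,
    setLIntegral_const, hc1, mul_comm, ← hc T hT,
    Measure.map_apply (hX.prodMk h.measurable_law) (hcell.prod hC)]
  congr 1
  ext ω
  simp [and_comm]

/-- Conjugacy: the posterior of a Dirichlet process prior adds a unit mass at each observation. -/
theorem hasCondDistrib_posteriorKernel {Ω : Type*} [MeasurableSpace Ω] {ρ : Measure Ω}
    [IsProbabilityMeasure ρ] {P : Ω → ProbabilityMeasure 𝕏} {n : ℕ} {X : Fin n → Ω → 𝕏}
    (hs : 0 < s) (hP : HasLaw P (dpPrior s α) ρ) (h : IsIIDSample ρ P X) :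
    HasCondDistrib P (fun ω i => X i ω) (posteriorKernel α hs n) ρ := by
  have hX := h.measurable_sampleVector
  have hXP := hX.prodMk h.measurable_law
  have := Measure.isProbabilityMeasure_map hX.aemeasurable (μ := ρ)
  have := Measure.isProbabilityMeasure_map hXP.aemeasurable (μ := ρ)
  refine ⟨hXP.aemeasurable, ext_of_generate_finite _
    (generateFrom_eq_prod generateFrom_pi generateFrom_cylinderSets.symm
      ⟨fun _ => Set.univ, fun _ => ⟨fun _ => Set.univ, fun _ _ => MeasurableSet.univ, by simp⟩,
        Set.iUnion_const _⟩
      ⟨fun _ => Set.univ, fun _ => univ_mem_cylinderSets, Set.iUnion_const _⟩).symm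
    (isPiSystem_pi.prod isPiSystem_cylinderSets) ?_ (by simp)⟩
  rintro _ ⟨_, ⟨A, hA, rfl⟩, _, ⟨m₀, B₀, T₀, hB₀, hT₀, rfl⟩, rfl⟩
  obtain ⟨m, B, I, T, hB, hI, hT, hC⟩ := exists_partition_massVector hB₀.measurableSet
    (fun i => hA i trivial) hT₀
  -- The box `∏ A i` is the disjoint union of the products of cells of `B` contained in it.
  have hbox : Set.univ.pi A ×ˢ (massVector B₀ ⁻¹' T₀) = ⋃ j ∈ Fintype.piFinset I,
      (Set.univ.pi fun i => B (j i)) ×ˢ (massVector B ⁻¹' T) := by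
    rw [hC]
    ext ⟨x, Q⟩
    simp only [Set.mem_prod, Set.mem_pi, Set.mem_univ, true_imp_iff, Set.mem_iUnion,
      Fintype.mem_piFinset, exists_prop, hI]
    constructor
    · rintro ⟨h1, h2⟩
      choose j hj hj' using h1
      exact ⟨j, hj, hj', h2⟩
    · rintro ⟨j, hj, hj', h2⟩
      exact ⟨fun i => ⟨j i, hj i, hj' i⟩, h2⟩
  have hdisj : (Fintype.piFinset I : Set (Fin n → Fin m)).PairwiseDisjoint fun j =>
      (Set.univ.pi fun i => B (j i)) ×ˢ (massVector B ⁻¹' T) := by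
    intro j _ k _ hjk
    obtain ⟨i, hi⟩ := Function.ne_iff.1 hjk
    refine Set.disjoint_left.2 fun q hq hq' => ?_
    exact Set.disjoint_left.1 (hB.pairwise_disjoint hi) (hq.1 i trivial) (hq'.1 i trivial)
  have hmeas (j : Fin n → Fin m) :
      MeasurableSet ((Set.univ.pi fun i => B (j i)) ×ˢ (massVector B ⁻¹' T)) :=
    (MeasurableSet.univ_pi fun i => hB.measurableSet (j i)).prod
      (measurable_massVector hB.measurableSet hT)
  simp only
  rw [hbox, measure_biUnion_finset hdisj fun j _ => hmeas j,
    measure_biUnion_finset hdisj fun j _ => hmeas j]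
  exact Finset.sum_congr rfl fun j _ =>
    measure_cell_prod_massVector_preimage α hs hP h hB j hT

end

/-! ### Posterior expectations -/

section

variable {𝕏 : Type*}

lemma convexCombination_sampleMean {s : ℝ} (hs : 0 < s) {n : ℕ} (x : Fin n → 𝕏) (f : 𝕏 → ℝ) (c : ℝ) :
    s / (s + n) * c + n / (s + n) * sampleMean x f = (s * c + ∑ i, f (x i)) / (s + n) := by
  have hsn : s + n ≠ 0 := by positivity
  rcases Nat.eq_zero_or_pos n with rfl | hn
  · simp; field_simp
  · have : (n : ℝ) ≠ 0 := by positivity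
    rw [sampleMean]
    field_simp

variable [MeasurableSpace 𝕏]

lemma isMeasurablePartition_compl {A : Set 𝕏} (hA : MeasurableSet A) :
    IsMeasurablePartition ![A, Aᶜ] where
  measurableSet i := by fin_cases i; exacts [hA, hA.compl]
  pairwise_disjoint i j hij := by
    fin_cases i <;> fin_cases j <;> simp_all [disjoint_compl_right, disjoint_compl_left]
  iUnion_eq := by
    ext y
    simpa [Fin.exists_fin_two] using em (y ∈ A)

/-- The mean of a Dirichlet process is its normalized base measure. -/
lemma IsDirichletProcess.bind_eq {β : Measure 𝕏} [IsFiniteMeasure β]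
    {μ : Measure (ProbabilityMeasure 𝕏)} (h : IsDirichletProcess β μ) (hβ : β ≠ 0) :
    μ.bind (fun P => (P : Measure 𝕏)) = (β Set.univ)⁻¹ • β := by
  ext A hA
  have hB := isMeasurablePartition_compl hA
  have hcoe : Measurable fun P : ProbabilityMeasure 𝕏 => (P : Measure 𝕏) := measurable_subtype_coe
  have hpos : 0 < β.real Set.univ :=
    ENNReal.toReal_pos (by simpa using hβ) (measure_ne_top _ _)
  have hsum := sum_measureReal_partition β hB.measurableSet hB.pairwise_disjoint hB.iUnion_eq
  have hmean := lintegral_eval_mul_dirichletMeasure (a := fun i => β.real (![A, Aᶜ] i))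
    (fun i => measureReal_nonneg) (hsum ▸ hpos) 0 (measurable_const (a := (1 : ℝ≥0∞)))
  rw [hsum, lintegral_const, measure_univ, ← h.map_massVector hB,
    lintegral_map (by fun_prop) (measurable_massVector hB.measurableSet)] at hmean
  rw [Measure.bind_apply hA hcoe.aemeasurable, Measure.smul_apply, smul_eq_mul,
    ← ENNReal.div_eq_inv_mul, ← ofReal_measureReal (μ := β) (s := A),
    ← ofReal_measureReal (μ := β) (s := Set.univ), ← ENNReal.ofReal_div_of_pos hpos]
  simpa [massVector] using hmean

lemma IsDirichletProcess.integral_integral {β : Measure 𝕏} [IsFiniteMeasure β]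
    {μ : Measure (ProbabilityMeasure 𝕏)} (h : IsDirichletProcess β μ) (hβ : β ≠ 0) {f : 𝕏 → ℝ}
    (hf : Integrable f β) :
    ∫ P : ProbabilityMeasure 𝕏, (∫ y, f y ∂(P : Measure 𝕏)) ∂μ =
      (β.real Set.univ)⁻¹ * ∫ y, f y ∂β := by
  have hne : (β Set.univ)⁻¹ ≠ ∞ := by simpa using hβ
  let K : Kernel (ProbabilityMeasure 𝕏) 𝕏 := ⟨fun P => (P : Measure 𝕏), measurable_subtype_coe⟩
  have hK : (K ∘ₖ Kernel.const Unit μ) () = (β Set.univ)⁻¹ • β := by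
    rw [Kernel.comp_apply, Kernel.const_apply]
    exact h.bind_eq hβ
  have hint : Integrable f ((K ∘ₖ Kernel.const Unit μ) ()) := by
    rw [hK]
    exact hf.smul_measure hne
  have := Kernel.integral_comp hint
  rw [hK, integral_smul_measure, Kernel.const_apply, ENNReal.toReal_inv, smul_eq_mul] at this
  exact this.symm

variable {s : ℝ}

lemma integrable_of_bounded {f : 𝕏 → ℝ} (hf : Measurable f) (hb : ∃ M, ∀ y, |f y| ≤ M)
    (μ : Measure 𝕏) [IsFiniteMeasure μ] : Integrable f μ := by
  obtain ⟨M, hM⟩ := hb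
  exact Integrable.of_bound hf.aestronglyMeasurable M (ae_of_all _ hM)

lemma posteriorExpectation_eq (hs : 0 < s) (α : ProbabilityMeasure 𝕏) {n : ℕ} (x : Fin n → 𝕏)
    {f : 𝕏 → ℝ} (hf : Measurable f) (hb : ∃ M, ∀ y, |f y| ≤ M) :
    posteriorExpectation s α x f =
      (s * ∫ y, f y ∂(α : Measure 𝕏) + ∑ i, f (x i)) / (s + n) := by
  have hint := integrable_of_bounded hf hb
  rw [posteriorExpectation, (isDirichletProcess_dpPosterior α hs x).integral_integral
      (posteriorBase_ne_zero α hs x) (hint _), posteriorBase_real_univ α hs x,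
    integral_add_measure ((hint _).smul_measure ENNReal.ofReal_ne_top)
      (hint _), integral_smul_measure,
    integral_finsetSum_measure fun i _ => hint _, ENNReal.toReal_ofReal hs.le, smul_eq_mul]
  simp only [integral_dirac' f _ hf.stronglyMeasurable]
  rw [div_eq_inv_mul]

lemma mem_idpPosteriorExpectations (hs : 0 < s) (y : 𝕏) {n : ℕ} (x : Fin n → 𝕏) {f : 𝕏 → ℝ}
    (hf : Measurable f) (hb : ∃ M, ∀ y, |f y| ≤ M) :
    (s * f y + ∑ i, f (x i)) / (s + n) ∈ idpPosteriorExpectations s x f := by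
  refine ⟨(⟨Measure.dirac y, inferInstance⟩ : ProbabilityMeasure 𝕏),
    (posteriorExpectation_eq hs _ x hf hb).trans ?_⟩
  simp [integral_dirac' f y hf.stronglyMeasurable]

variable [Nonempty 𝕏]

lemma isLUB_idpPosteriorExpectations (hs : 0 < s) {n : ℕ} (x : Fin n → 𝕏) {f : 𝕏 → ℝ}
    (hf : Measurable f) (hb : ∃ M, ∀ y, |f y| ≤ M) :
    IsLUB (idpPosteriorExpectations s x f)
      (s / (s + n) * (⨆ y, f y) + n / (s + n) * sampleMean x f) := by
  have hsn : 0 < s + n := by positivity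
  rw [convexCombination_sampleMean hs]
  obtain ⟨M, hM⟩ := hb
  have hbdd : BddAbove (Set.range f) := ⟨M, by rintro _ ⟨y, rfl⟩; exact (abs_le.1 (hM y)).2⟩
  constructor
  · rintro _ ⟨α, rfl⟩
    simp only
    rw [posteriorExpectation_eq hs α x hf ⟨M, hM⟩]
    have : ∫ y, f y ∂(α : Measure 𝕏) ≤ ⨆ y, f y := by
      calc ∫ y, f y ∂(α : Measure 𝕏) ≤ ∫ _, (⨆ y, f y) ∂(α : Measure 𝕏) :=
            integral_mono (integrable_of_bounded hf ⟨M, hM⟩ _) (integrable_const _)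
              fun y => le_ciSup hbdd y
        _ = ⨆ y, f y := by simp
    gcongr
  · intro b hb
    have hle (y : 𝕏) : f y ≤ (b * (s + n) - ∑ i, f (x i)) / s := by
      have := hb (mem_idpPosteriorExpectations hs y x hf ⟨M, hM⟩)
      rw [div_le_iff₀ hsn] at this
      rw [le_div_iff₀ hs]
      linarith
    have := ciSup_le hle
    rw [le_div_iff₀ hs] at this
    rw [div_le_iff₀ hsn]
    linarith

lemma isGLB_idpPosteriorExpectations (hs : 0 < s) {n : ℕ} (x : Fin n → 𝕏) {f : 𝕏 → ℝ}
    (hf : Measurable f) (hb : ∃ M, ∀ y, |f y| ≤ M) :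
    IsGLB (idpPosteriorExpectations s x f)
      (s / (s + n) * (⨅ y, f y) + n / (s + n) * sampleMean x f) := by
  have hsn : 0 < s + n := by positivity
  rw [convexCombination_sampleMean hs]
  obtain ⟨M, hM⟩ := hb
  have hbdd : BddBelow (Set.range f) := ⟨-M, by rintro _ ⟨y, rfl⟩; exact (abs_le.1 (hM y)).1⟩
  constructor
  · rintro _ ⟨α, rfl⟩
    simp only
    rw [posteriorExpectation_eq hs α x hf ⟨M, hM⟩]
    have : ⨅ y, f y ≤ ∫ y, f y ∂(α : Measure 𝕏) := by
      calc ⨅ y, f y = ∫ _, (⨅ y, f y) ∂(α : Measure 𝕏) := by simp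
        _ ≤ ∫ y, f y ∂(α : Measure 𝕏) :=
            integral_mono (integrable_const _) (integrable_of_bounded hf ⟨M, hM⟩ _)
              fun y => ciInf_le hbdd y
    gcongr
  · intro b hb
    have hle (y : 𝕏) : (b * (s + n) - ∑ i, f (x i)) / s ≤ f y := by
      have := hb (mem_idpPosteriorExpectations hs y x hf ⟨M, hM⟩)
      rw [le_div_iff₀ hsn] at this
      rw [div_le_iff₀ hs]
      linarith
    have := le_ciInf hle
    rw [div_le_iff₀ hs] at this
    rw [le_div_iff₀ hsn]
    linarith

lemma sSup_sub_sInf_idpPosteriorExpectations (hs : 0 < s) {n : ℕ} (x : Fin n → 𝕏) {f : 𝕏 → ℝ}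
    (hf : Measurable f) (hb : ∃ M, ∀ y, |f y| ≤ M) :
    sSup (idpPosteriorExpectations s x f) - sInf (idpPosteriorExpectations s x f) =
      s / (s + n) * ((⨆ y, f y) - ⨅ y, f y) := by
  have hne : (idpPosteriorExpectations s x f).Nonempty :=
    ⟨_, mem_idpPosteriorExpectations hs (Classical.arbitrary 𝕏) x hf hb⟩
  rw [(isLUB_idpPosteriorExpectations hs x hf hb).csSup_eq hne,
    (isGLB_idpPosteriorExpectations hs x hf hb).csInf_eq hne]
  ring

end

theorem theorem2 {𝕏 : Type u} [MeasurableSpace 𝕏] [StandardBorelSpace 𝕏] [Nonempty 𝕏]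
    (s : ℝ) (hs : 0 < s) :
    -- for every finite nonzero base measure, `dirichletProcess` is the unique Dirichlet process law
    (∀ β : Measure 𝕏, IsFiniteMeasure β → β ≠ 0 →
      IsDirichletProcess β (dirichletProcess β) ∧
        ∀ μ, IsDirichletProcess β μ → μ = dirichletProcess β) ∧
    -- for each prior `Dp(s, α)`, `dpPosterior s α x` is the posterior law of `P` given `X = x`
    (∀ (n : ℕ) (α : ProbabilityMeasure 𝕏),
      ∃ κ : Kernel (Fin n → 𝕏) (ProbabilityMeasure 𝕏), IsMarkovKernel κ ∧
        (∀ x, κ x = dpPosterior s α x) ∧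
        ∀ (Ω : Type v) [MeasurableSpace Ω] (ρ : Measure Ω) [IsProbabilityMeasure ρ]
          (P : Ω → ProbabilityMeasure 𝕏) (X : Fin n → Ω → 𝕏),
          HasLaw P (dpPrior s α) ρ → IsIIDSample ρ P X →
            HasCondDistrib P (fun ω i => X i ω) κ ρ) ∧
    -- the lower and upper posterior expectations, and the imprecision
    (∀ f : 𝕏 → ℝ, Measurable f → (∃ M, ∀ y, |f y| ≤ M) →
      (∀ (n : ℕ) (x : Fin n → 𝕏),
        IsGLB (idpPosteriorExpectations s x f)
          (s / (s + n) * (⨅ y, f y) + n / (s + n) * sampleMean x f) ∧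
        IsLUB (idpPosteriorExpectations s x f)
          (s / (s + n) * (⨆ y, f y) + n / (s + n) * sampleMean x f)) ∧
      ∀ x : ℕ → 𝕏,
        (∀ n : ℕ,
          sSup (idpPosteriorExpectations s (fun i : Fin n => x i) f) -
            sInf (idpPosteriorExpectations s (fun i : Fin n => x i) f) =
          s / (s + n) * ((⨆ y, f y) - ⨅ y, f y)) ∧
        Tendsto (fun n : ℕ =>
          sSup (idpPosteriorExpectations s (fun i : Fin n => x i) f) -
            sInf (idpPosteriorExpectations s (fun i : Fin n => x i) f)) atTop (𝓝 0)) := by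
  refine ⟨fun β _ hβ => ?_, fun n α => ?_, fun f hf hb => ⟨fun n x => ?_, fun x => ?_⟩⟩
  · have h := isDirichletProcess_dirichletProcess β hβ
    exact ⟨h, fun μ hμ => hμ.unique h⟩
  · exact ⟨posteriorKernel α hs n, inferInstance, fun x => rfl,
      fun Ω _ ρ _ P X hP hX => hasCondDistrib_posteriorKernel α hs hP hX⟩
  · exact ⟨isGLB_idpPosteriorExpectations hs x hf hb, isLUB_idpPosteriorExpectations hs x hf hb⟩
  · have hdiff (n : ℕ) := sSup_sub_sInf_idpPosteriorExpectations hs (fun i : Fin n => x i) hf hb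
    refine ⟨hdiff, ?_⟩
    simp only [hdiff]
    have hlim : Tendsto (fun n : ℕ => s / (s + n)) atTop (𝓝 0) :=
      tendsto_const_nhds.div_atTop
        (tendsto_atTop_add_const_left _ _ tendsto_natCast_atTop_atTop)
    simpa using hlim.mul_const ((⨆ y, f y) - ⨅ y, f y)
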